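/- Let $\lambda>0$, $\mathcal T>0$, let $\mathbb T=\mathbb R/\mathcal T\mathbb Z$ carry the normalized Haar measure, and let $G=\mathbb T\times\mathbb R^3$, with dual group $\mathbb Z\times\mathbb R^3$. Let $\phi_\perp$ be the purely periodic part of the time-periodic vorticity fundamental solution, that is, the tempered distribution on $G$ $$\phi_\perp:=\mathscr F_G^{-1}\Big[\frac{1-\delta_{\mathbb Z}(k)}{|\xi|^2-i\lambda\xi_1+i\frac{2\pi}{\mathcal T}k}\Big],$$ where $\delta_{\mathbb Z}(k)=1$ for $k=0$ and $\delta_{\mathbb Z}(k)=0$ otherwise, and $\mathscr F_G^{-1}[g](t,x)=(2\pi)^{-3}\sum_{k\in\mathbb Z}\int_{\mathbb R^3}g(k,\xi)\,e^{i\frac{2\pi}{\mathcal T}kt+ix\cdot\xi}\,\mathrm d\xi$, extended to tempered distributions by duality. Then $\phi_\perp$ and its distributional spatial gradient are given by functions on $G$; on $\mathbb T\times(\mathbb R^3\setminus\{0\})$, $\phi_\perp$ is continuous and continuously differentiable in $x$ with jointly continuous gradient $\nabla\phi_\perp$. There is a constant $C_3=C_3(\lambda,\mathcal T)>0$ such that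 for all $\gamma\in(0,1)$ and $q\in[1,\frac1{1-\gamma})$ there is a constant $C=C(\lambda,\mathcal T,q,\gamma)>0$ such that for all $x\in\mathbb R^3\setminus\{0\}$ $$\|\phi_\perp(\cdot,x)\|_{L^q(\mathbb T)}\le C|x|^{-(1+2\gamma)}e^{-C_3|x|},\qquad \|\nabla\phi_\perp(\cdot,x)\|_{L^q(\mathbb T)}\le C|x|^{-(2+2\gamma)}e^{-C_3|x|}.$$ -/

import Mathlib

open MeasureTheory Set
open scoped ContDiff ENNReal

noncomputable section

namespace TimePeriodic

/-- Three-dimensional Euclidean space. -/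
abbrev E3 : Type := EuclideanSpace ℝ (Fin 3)

/-- The normalized Haar measure on the group `G = 𝕋 × ℝ³`, `𝕋 = ℝ / T ℤ`:
normalized (total mass one) in time, Lebesgue in space. -/
def haarG (T : ℝ) [Fact (0 < T)] : Measure (AddCircle T × E3) :=
  (AddCircle.haarAddCircle (T := T)).prod (volume : Measure E3)

/-- The lift of a function on `𝕋 × ℝ³` to a function on `ℝ × ℝ³` that is `T`-periodic in time. -/
def lift (T : ℝ) {F : Type*} (ψ : AddCircle T → E3 → F) : ℝ × E3 → F :=
  fun z => ψ (z.1 : AddCircle T) z.2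

/-- The Schwartz–Bruhat space of `G = 𝕋 × ℝ³`: smooth functions all of whose derivatives
decay in `x` faster than any power of `|x|`, uniformly in time. -/
def IsSchwartzBruhat (T : ℝ) (ψ : AddCircle T → E3 → ℂ) : Prop :=
  ContDiff ℝ ∞ (lift T ψ) ∧
    ∀ k n : ℕ, ∃ C : ℝ, ∀ z : ℝ × E3, ‖z.2‖ ^ k * ‖iteratedFDeriv ℝ n (lift T ψ) z‖ ≤ C

/-- The Fourier transform on `G`:
`∫_𝕋 ∫_{ℝ³} ψ(t,x) exp(-i (2π/T) k t - i x·ξ) dx dt`. Here `fourier (-k) t` is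
`exp(-i (2π/T) k t)`. -/
def fourierG (T : ℝ) [Fact (0 < T)] (ψ : AddCircle T → E3 → ℂ) (k : ℤ) (ξ : E3) : ℂ :=
  ∫ z, ψ z.1 z.2 * (fourier (-k) z.1 * Complex.exp (-(Complex.I * (inner ℝ z.2 ξ : ℝ))))
    ∂(haarG T)

/-- The inverse Fourier transform on `G`, in the sense of tempered distributions, of a (bounded
measurable) function `m` on the dual group `ℤ × ℝ³`. By duality its value at a test function `ψ`
is `∑ₖ ∫ m(k,ξ) (∫_G ψ(t,x) exp(i (2π/T) k t + i x·ξ) d(t,x)) dξ`, where the measure `dξ` is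
Lebesgue measure divided by `(2π)³` so that Fourier inversion holds on `G`. -/
def invFourierG (T : ℝ) [Fact (0 < T)] (m : ℤ → E3 → ℂ) (ψ : AddCircle T → E3 → ℂ) : ℂ :=
  ∑' k : ℤ, ((2 * Real.pi : ℝ) ^ 3 : ℂ)⁻¹ * ∫ ξ : E3, m k ξ * fourierG T ψ (-k) (-ξ)

/-- The multiplier `(1 - δ_ℤ(k)) / (|ξ|² - i λ ξ₁ + i (2π/T) k)`. -/
def symbolPerp (lam T : ℝ) (k : ℤ) (ξ : E3) : ℂ :=
  (1 - (if k = 0 then 1 else 0)) /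
    ((‖ξ‖ ^ 2 : ℝ) - Complex.I * (lam * ξ 0 : ℝ) + Complex.I * (2 * Real.pi / T * k : ℝ))

/-- The purely periodic part `φ_⊥` of the vorticity fundamental solution, as a distribution
on `G` (a functional on the Schwartz–Bruhat functions). -/
def phiPerpDist (lam T : ℝ) [Fact (0 < T)] : (AddCircle T → E3 → ℂ) → ℂ :=
  invFourierG T (symbolPerp lam T)

/-- The spatial partial derivative `∂_j` of a function on `𝕋 × ℝ³`. -/
def pdx {T : ℝ} (j : Fin 3) (ψ : AddCircle T → E3 → ℂ) (t : AddCircle T) (x : E3) : ℂ :=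
  fderiv ℝ (ψ t) x (EuclideanSpace.single j 1)

/-- The spatial gradient of a function on `𝕋 × ℝ³`. -/
def gradx {T : ℝ} (ψ : AddCircle T → E3 → ℂ) (t : AddCircle T) (x : E3) :
    EuclideanSpace ℂ (Fin 3) :=
  WithLp.toLp 2 fun j => pdx j ψ t x

/-- The distributional spatial derivative `∂_j u`, `⟨∂_j u, ψ⟩ = -⟨u, ∂_j ψ⟩`. -/
def distPdx {T : ℝ} (j : Fin 3) (u : (AddCircle T → E3 → ℂ) → ℂ) :
    (AddCircle T → E3 → ℂ) → ℂ :=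
  fun ψ => -u (pdx j ψ)

/-- The distribution `u` on `G` is the regular distribution given by the function `f`. -/
def IsRegularDist (T : ℝ) [Fact (0 < T)] (u : (AddCircle T → E3 → ℂ) → ℂ)
    (f : AddCircle T → E3 → ℂ) : Prop :=
  ∀ ψ : AddCircle T → E3 → ℂ, IsSchwartzBruhat T ψ →
    Integrable (fun z : AddCircle T × E3 => f z.1 z.2 * ψ z.1 z.2) (haarG T) ∧
      u ψ = ∫ z, f z.1 z.2 * ψ z.1 z.2 ∂(haarG T)

/-- `φ` is the function `φ_⊥`: it represents the distribution `φ_⊥`, it is continuous and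
continuously differentiable in `x` on `𝕋 × (ℝ³ ∖ {0})`, and its pointwise gradient represents
the distributional gradient of `φ_⊥`. Continuity makes `φ(t,x)` and its gradient unique
for all `t` and all `x ≠ 0`. -/
structure IsPhiPerp (lam T : ℝ) [Fact (0 < T)] (φ : AddCircle T → E3 → ℂ) : Prop where
  regular : IsRegularDist T (phiPerpDist lam T) φ
  regular_grad : ∀ j, IsRegularDist T (distPdx j (phiPerpDist lam T)) (pdx j φ)
  continuousOn : ContinuousOn (fun z : AddCircle T × E3 => φ z.1 z.2) {z | z.2 ≠ 0}
  differentiableAt : ∀ t x, x ≠ 0 → DifferentiableAt ℝ (φ t) x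
  continuousOn_grad :
    ContinuousOn (fun z : AddCircle T × E3 => gradx φ z.1 z.2) {z | z.2 ≠ 0}

end TimePeriodic

end

noncomputable section

namespace TimePeriodic

open Filter Topology Complex

/-! Put a = λ/2, ϖ = 2π/T and let μ_k be the square root of a² + iϖk with positive real part.
Completing the square in ξ₁ shows that the k-th symbol is the Fourier transform of the drifted
Yukawa potential exp(-μ_k|x| - a x₁)/(4π|x|) (`yukawa_fourier`, `fourier_mode`), so φ_⊥ should be
the Fourier series in time with these coefficients. For k ≠ 0 one has Re μ_k ≥ a + c√|k|
(`exists_massRe_ge`): the drift is absorbed and a factor exp(-c√|k||x|) remains. There is no such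
gain at k = 0, which is absent here.

With m = 0 for φ_⊥ and m = 1 for its gradient, summing absolute values over k costs |x|⁻² and gives
|x|^(-(m+3)). Multiplying the series by exp(2πit/T) - 1 replaces the coefficients by their
consecutive differences; since μ_k - μ_{k-1} = O(|k|^(-1/2)), these sum to only |x|^(-(m+1)).
Interpolating the two bounds with exponents γ and 1 - γ (`norm_tsum_fourier_interpolate`) gives
|x|^(-(m+1+2γ)) times the weight |exp(2πit/T) - 1|^(-(1-γ)), which lies in L^q of the circle exactly
when q(1 - γ) < 1. This is the whole estimate (`IsAdmissible.norm_modeSum_le`,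
`eLpNorm_fourier_weight_lt_top`).

It remains to see that the series represents the distribution. Each mode is integrable and pairs
correctly by Fubini (`mode_pairing`); its distributional gradient has no mass at the origin
(`integral_screened_mul_fderiv`); and the sum over k commutes with the pairing, because the time
coefficients of a test function are O(1/|k|) (`IsAdmissible.hasSum_pairing`). -/

/-! ### Fourier–Laplace transform of the Yukawa potential. -/

/-- Subordination formula: the Gaussian average producing the Yukawa potential. -/
lemma integral_exp_div_mul_sqrt {r μ : ℝ} (hr : 0 < r) (hμ : 0 < μ) :
    IntegrableOn (fun s : ℝ => Real.exp (-r ^ 2 / (4 * s) - μ ^ 2 * s) / (s * √s)) (Ioi 0) ∧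
    ∫ s in Ioi (0 : ℝ), Real.exp (-r ^ 2 / (4 * s) - μ ^ 2 * s) / (s * √s) =
      2 * √Real.pi * Real.exp (-μ * r) / r := by
  set G : ℝ → ℝ := fun y => ∫ u in (0 : ℝ)..y, Real.exp (-u ^ 2) with hG
  have hgc : Continuous fun u : ℝ => Real.exp (-u ^ 2) := by fun_prop
  have hGd : ∀ y, HasDerivAt G (Real.exp (-y ^ 2)) y := fun y =>
    intervalIntegral.integral_hasDerivAt_right (hgc.intervalIntegrable _ _)
      (hgc.stronglyMeasurableAtFilter _ _) hgc.continuousAt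
  have hint : Integrable fun u : ℝ => Real.exp (-u ^ 2) := by
    simpa using integrable_exp_neg_mul_sq (b := 1) one_pos
  have hGtop : Tendsto G atTop (𝓝 (√Real.pi / 2)) := by
    have h := intervalIntegral_tendsto_integral_Ioi (μ := volume) (0 : ℝ) (f := fun u : ℝ => Real.exp (-u ^ 2))
      hint.integrableOn tendsto_id
    have h2 := integral_gaussian_Ioi 1
    simp only [neg_mul, one_mul, div_one] at h2
    rw [h2] at h
    exact h
  have hGodd : ∀ y, G (-y) = - G y := by
    intro y
    have := intervalIntegral.integral_comp_neg (a := 0) (b := y) (fun u : ℝ => Real.exp (-u ^ 2))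
    simp only [even_two, Even.neg_pow, neg_zero] at this
    rw [hG]; simp only
    rw [this, ← intervalIntegral.integral_symm]
  have hGbot : Tendsto G atBot (𝓝 (-(√Real.pi / 2))) := by
    have h := (hGtop.comp tendsto_neg_atBot_atTop).neg
    refine h.congr fun y => ?_
    simp [hGodd]
  -- The integrand has an explicit primitive in terms of the error function `G`. Completing squares,
  -- exp(-μr - v²) and exp(μr - w²) both equal exp(-r²/(4s) - μ²s), and v' - w' = (r/2)/(s√s).
  -- Between 0 and ∞ the `w` terms cancel, while `v` runs over all of ℝ.
  set v : ℝ → ℝ := fun s => μ * √s - r / 2 * (√s)⁻¹ with hv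
  set w : ℝ → ℝ := fun s => μ * √s + r / 2 * (√s)⁻¹ with hw
  set H : ℝ → ℝ := fun s => Real.exp (-μ * r) * G (v s) - Real.exp (μ * r) * G (w s) with hH
  have hsq0 : Tendsto (fun s : ℝ => √s) (𝓝[>] 0) (𝓝[>] 0) := by
    refine tendsto_nhdsWithin_iff.2 ⟨?_, ?_⟩
    · have := (Real.continuous_sqrt.tendsto 0).mono_left (nhdsWithin_le_nhds (s := Ioi 0))
      simpa using this
    · filter_upwards [self_mem_nhdsWithin] with s hs using Real.sqrt_pos.2 hs
  have hsqi0 : Tendsto (fun s : ℝ => r / 2 * (√s)⁻¹) (𝓝[>] 0) atTop :=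
    (tendsto_inv_nhdsGT_zero.comp hsq0).const_mul_atTop (by positivity)
  have hsq0' : Tendsto (fun s : ℝ => μ * √s) (𝓝[>] 0) (𝓝 0) := by
    simpa using (hsq0.mono_right nhdsWithin_le_nhds).const_mul μ
  have hsqt : Tendsto (fun s : ℝ => μ * √s) atTop atTop :=
    Real.tendsto_sqrt_atTop.const_mul_atTop hμ
  have hsqit : Tendsto (fun s : ℝ => r / 2 * (√s)⁻¹) atTop (𝓝 0) := by
    simpa using (tendsto_inv_atTop_zero.comp Real.tendsto_sqrt_atTop).const_mul (r / 2)
  have hv0 : Tendsto v (𝓝[>] 0) atBot := by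
    have := hsq0'.add_atBot (tendsto_neg_atTop_atBot.comp hsqi0)
    exact this.congr fun s => by simp [hv, sub_eq_add_neg]
  have hw0 : Tendsto w (𝓝[>] 0) atTop := hsq0'.add_atTop hsqi0
  have hvt : Tendsto v atTop atTop := by
    have := hsqt.atTop_add hsqit.neg
    exact this.congr fun s => by simp [hv, sub_eq_add_neg]
  have hwt : Tendsto w atTop atTop := hsqt.atTop_add hsqit
  set l : ℝ := Real.exp (-μ * r) * (-(√Real.pi / 2)) - Real.exp (μ * r) * (√Real.pi / 2) with hl
  have hH0 : Tendsto H (𝓝[>] 0) (𝓝 l) :=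
    ((hGbot.comp hv0).const_mul _).sub ((hGtop.comp hw0).const_mul _)
  have hHt : Tendsto H atTop (𝓝 (Real.exp (-μ * r) * (√Real.pi / 2) -
      Real.exp (μ * r) * (√Real.pi / 2))) :=
    ((hGtop.comp hvt).const_mul _).sub ((hGtop.comp hwt).const_mul _)
  have hder : ∀ s ∈ Ioi (0 : ℝ), HasDerivAt H
      (r / 2 * (Real.exp (-r ^ 2 / (4 * s) - μ ^ 2 * s) / (s * √s))) s := by
    intro s hs
    have hs : 0 < s := hs
    have hss : 0 < √s := Real.sqrt_pos.2 hs
    have h1 : HasDerivAt (fun s : ℝ => √s) (1 / (2 * √s)) s := Real.hasDerivAt_sqrt hs.ne'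
    have h2 : HasDerivAt (fun s : ℝ => (√s)⁻¹) (-(1 / (2 * √s)) / (√s) ^ 2) s := h1.inv hss.ne'
    have hv' := (h1.const_mul μ).sub (h2.const_mul (r / 2))
    have hw' := (h1.const_mul μ).add (h2.const_mul (r / 2))
    have := (((hGd _).comp s hv').const_mul (Real.exp (-μ * r))).sub
      (((hGd _).comp s hw').const_mul (Real.exp (μ * r)))
    refine this.congr_deriv ?_
    obtain ⟨y, hy, rfl⟩ : ∃ y : ℝ, 0 < y ∧ s = y ^ 2 := ⟨√s, hss, (Real.sq_sqrt hs.le).symm⟩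
    simp only [Pi.sub_apply, Pi.add_apply, Real.sqrt_sq hy.le]
    have e1 : Real.exp (-μ * r) * Real.exp (-(μ * y - r / 2 * y⁻¹) ^ 2) =
        Real.exp (-r ^ 2 / (4 * y ^ 2) - μ ^ 2 * y ^ 2) := by
      rw [← Real.exp_add]; congr 1; field_simp; ring
    have e2 : Real.exp (μ * r) * Real.exp (-(μ * y + r / 2 * y⁻¹) ^ 2) =
        Real.exp (-r ^ 2 / (4 * y ^ 2) - μ ^ 2 * y ^ 2) := by
      rw [← Real.exp_add]; congr 1; field_simp; ring
    rw [← mul_assoc, ← mul_assoc, e1, e2]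
    field_simp
    ring
  -- The value of `H` at 0 comes from the convention 0⁻¹ = 0 and is not its right limit `l`, hence
  -- the update.
  have hc : ContinuousWithinAt (Function.update H 0 l) (Ici 0) 0 := by
    have := (continuousWithinAt_update_same (f := H) (s := Ici (0 : ℝ)) (x := 0) (y := l)).2
    refine this ?_
    have : Ici (0 : ℝ) \ {0} = Ioi 0 := by ext; simp [lt_iff_le_and_ne, eq_comm]
    rw [this]; exact hH0
  have hder' : ∀ s ∈ Ioi (0 : ℝ), HasDerivAt (Function.update H 0 l)
      (r / 2 * (Real.exp (-r ^ 2 / (4 * s) - μ ^ 2 * s) / (s * √s))) s := by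
    intro s hs
    refine (hder s hs).congr_of_eventuallyEq ?_
    filter_upwards [lt_mem_nhds (show (0 : ℝ) < s from hs)] with y hy
    simp [Function.update_of_ne hy.ne']
  have hpos : ∀ s ∈ Ioi (0 : ℝ),
      0 ≤ r / 2 * (Real.exp (-r ^ 2 / (4 * s) - μ ^ 2 * s) / (s * √s)) := by
    intro s hs
    have : (0 : ℝ) < s := hs
    positivity
  have hHt' : Tendsto (Function.update H 0 l) atTop (𝓝 (Real.exp (-μ * r) * (√Real.pi / 2) -
      Real.exp (μ * r) * (√Real.pi / 2))) := by
    refine hHt.congr' ?_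
    filter_upwards [eventually_gt_atTop 0] with y hy
    simp [Function.update_of_ne hy.ne']
  -- Since the derivative is nonnegative, integrability follows from the existence of the limit at
  -- infinity.
  have hI := integrableOn_Ioi_deriv_of_nonneg hc hder' hpos hHt'
  have hE := integral_Ioi_of_hasDerivAt_of_nonneg hc hder' hpos hHt'
  constructor
  · have := hI.const_mul (2 / r)
    refine this.congr (Eventually.of_forall fun s => ?_)
    simp only; field_simp
  · rw [integral_const_mul] at hE
    simp only [Function.update_self] at hE
    rw [hl] at hE
    rw [eq_div_iff hr.ne']
    linarith

/-- Polar coordinates reduce this to a Gamma-type integral. The space is general because the bound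
is used both on ℝ³ and on ℝ, the latter for the weight in time. -/
lemma integrable_norm_rpow_mul_exp_finrank {V : Type*} [NormedAddCommGroup V] [NormedSpace ℝ V]
    [FiniteDimensional ℝ V] [Nontrivial V] [MeasureSpace V] [BorelSpace V]
    [(volume : Measure V).IsAddHaarMeasure] {s c : ℝ} (hs : s < Module.finrank ℝ V) (hc : 0 < c) :
    Integrable fun x : V => ‖x‖ ^ (-s) * Real.exp (-(c * ‖x‖)) := by
  rw [integrable_fun_norm_addHaar volume (f := fun y : ℝ => y ^ (-s) * Real.exp (-(c * y)))]
  have hd : 1 ≤ Module.finrank ℝ V := Module.finrank_pos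
  have h := integrableOn_rpow_mul_exp_neg_mul_rpow (p := 1) (s := (Module.finrank ℝ V - 1 : ℕ) - s)
    (b := c) (by push_cast [hd]; linarith) one_pos hc
  refine h.congr_fun (fun y hy => ?_) measurableSet_Ioi
  have hy : (0 : ℝ) < y := hy
  simp only [Real.rpow_one, smul_eq_mul]
  rw [← mul_assoc, ← Real.rpow_natCast, ← Real.rpow_add hy, neg_mul, sub_eq_add_neg]

lemma integrable_norm_rpow_mul_exp {s c : ℝ} (hs : s < 3) (hc : 0 < c) :
    Integrable fun x : E3 => ‖x‖ ^ (-s) * Real.exp (-(c * ‖x‖)) :=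
  integrable_norm_rpow_mul_exp_finrank (by simpa using hs) hc

lemma integrable_gaussian_mul_cexp {s : ℝ} (hs : 0 < s) (ζ : Fin 3 → ℂ) :
    Integrable (fun x : E3 => cexp (-(‖x‖ ^ 2 / (4 * s) : ℝ) + ∑ i, ζ i * x i)) := by
  rw [← (PiLp.volume_preserving_toLp (Fin 3)).integrable_comp_emb
    (MeasurableEquiv.toLp 2 _).measurableEmbedding]
  have hb : 0 < ((1 / (4 * s) : ℝ) : ℂ).re := by rw [ofReal_re]; positivity
  refine (GaussianFourier.integrable_cexp_neg_mul_sum_add hb ζ).congr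
    (Eventually.of_forall fun v => ?_)
  simp only [Function.comp_def, EuclideanSpace.norm_sq_eq, Real.norm_eq_abs, sq_abs]
  push_cast
  congr 2
  ring

lemma integral_gaussian_mul_cexp {s : ℝ} (hs : 0 < s) (ζ : Fin 3 → ℂ) :
    ∫ x : E3, cexp (-(‖x‖ ^ 2 / (4 * s) : ℝ) + ∑ i, ζ i * x i) =
      (8 * (Real.pi * √Real.pi) * (s * √s) : ℝ) * cexp (s * ∑ i, ζ i ^ 2) := by
  rw [← (PiLp.volume_preserving_toLp (Fin 3)).integral_comp
    (MeasurableEquiv.toLp 2 _).measurableEmbedding]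
  have hb : 0 < ((1 / (4 * s) : ℝ) : ℂ).re := by rw [ofReal_re]; positivity
  have h := GaussianFourier.integral_cexp_neg_mul_sum_add hb ζ
  have e1 : ((Real.pi : ℂ) / ((1 / (4 * s) : ℝ) : ℂ)) ^ ((Fintype.card (Fin 3) : ℂ) / 2) =
      ((8 * (Real.pi * √Real.pi) * (s * √s) : ℝ) : ℂ) := by
    have h1 : (Real.pi : ℂ) / ((1 / (4 * s) : ℝ) : ℂ) = ((4 * s * Real.pi : ℝ) : ℂ) := by
      push_cast
      have : (s : ℂ) ≠ 0 := ofReal_ne_zero.2 hs.ne'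
      field_simp
    have h2 : ((Fintype.card (Fin 3) : ℂ) / 2) = ((3 / 2 : ℝ) : ℂ) := by simp
    have hp : (0 : ℝ) ≤ 4 * s * Real.pi := by positivity
    rw [h1, h2, ← ofReal_cpow hp]
    congr 1
    have h3 : (3 / 2 : ℝ) = 1 + 1 / 2 := by norm_num
    rw [h3, Real.rpow_add (by positivity), Real.rpow_one, ← Real.sqrt_eq_rpow,
      Real.sqrt_mul (by positivity), Real.sqrt_mul (by norm_num)]
    have : √(4 : ℝ) = 2 := by
      rw [show (4 : ℝ) = 2 ^ 2 by norm_num]; exact Real.sqrt_sq (by norm_num)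
    rw [this]; ring
  rw [e1] at h
  have e2 : (∑ i, ζ i ^ 2) / (4 * ((1 / (4 * s) : ℝ) : ℂ)) = s * ∑ i, ζ i ^ 2 := by
    push_cast
    have : (s : ℂ) ≠ 0 := ofReal_ne_zero.2 hs.ne'
    field_simp
  rw [e2] at h
  rw [← h]
  congr 1
  ext v
  simp only [EuclideanSpace.norm_sq_eq, Real.norm_eq_abs, sq_abs]
  push_cast
  congr 2
  ring

lemma norm_cexp_sum (ζ : Fin 3 → ℂ) (x : E3) :
    ‖cexp (∑ i, ζ i * x i)‖ = Real.exp (∑ i, (ζ i).re * x i) := by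
  rw [Complex.norm_exp]; simp

/-- By subordination the Yukawa potential is a superposition of Gaussians. Fubini and the Gaussian
integral leave ∫ exp(-(μ² - Σζᵢ²)s) ds. Absolute convergence involves only Re ζ, whence the
hypothesis. -/
lemma yukawa_fourier_real {μ : ℝ} (hμ : 0 < μ) {ζ : Fin 3 → ℂ}
    (hζ : ∑ i, (ζ i).re ^ 2 < μ ^ 2) :
    (∫ x : E3, cexp (-μ * ‖x‖) / ‖x‖ * cexp (∑ i, ζ i * x i)) * (μ ^ 2 - ∑ i, ζ i ^ 2) =
      4 * Real.pi := by
  set F : ℝ → E3 → ℂ := fun s x =>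
    (Real.exp (-‖x‖ ^ 2 / (4 * s) - μ ^ 2 * s) / (s * √s) : ℝ) * cexp (∑ i, ζ i * x i) with hF
  set J : Measure ℝ := volume.restrict (Ioi 0) with hJ
  have hFeq : ∀ s : ℝ, ∀ x : E3, F s x = (Real.exp (-(μ ^ 2 * s)) / (s * √s) : ℝ) *
      cexp (-(‖x‖ ^ 2 / (4 * s) : ℝ) + ∑ i, ζ i * x i) := by
    intro s x
    rw [hF]
    simp only
    rw [Complex.exp_add, ← mul_assoc]
    congr 1
    push_cast
    rw [sub_eq_add_neg, Complex.exp_add, neg_div]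
    ring
  have hFi : ∀ s : ℝ, 0 < s → ∫ x, F s x = (8 * (Real.pi * √Real.pi) : ℝ) *
      cexp (-(μ ^ 2 - ∑ i, ζ i ^ 2) * s) := by
    intro s hs
    simp_rw [hFeq]
    rw [integral_const_mul, integral_gaussian_mul_cexp hs]
    have h1 : (s : ℂ) ≠ 0 := ofReal_ne_zero.2 hs.ne'
    have h2 : ((√s : ℝ) : ℂ) ≠ 0 := ofReal_ne_zero.2 (Real.sqrt_pos.2 hs).ne'
    rw [show -((μ : ℂ) ^ 2 - ∑ i, ζ i ^ 2) * s = -(μ ^ 2 * s) + s * ∑ i, ζ i ^ 2 by ring,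
      Complex.exp_add]
    push_cast
    field_simp
  have hFn : ∀ s : ℝ, 0 < s → ∫ x, ‖F s x‖ = (8 * (Real.pi * √Real.pi) : ℝ) *
      Real.exp (-(μ ^ 2 - ∑ i, (ζ i).re ^ 2) * s) := by
    intro s hs
    have h := integral_gaussian_mul_cexp hs (fun i => ((ζ i).re : ℂ))
    have e : ∀ x : E3, cexp (-(‖x‖ ^ 2 / (4 * s) : ℝ) + ∑ i, ((ζ i).re : ℂ) * x i) =
        (Real.exp (-(‖x‖ ^ 2 / (4 * s)) + ∑ i, (ζ i).re * x i) : ℝ) := by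
      intro x; push_cast; rfl
    simp_rw [e] at h
    rw [integral_complex_ofReal] at h
    have h' : ∫ x : E3, Real.exp (-(‖x‖ ^ 2 / (4 * s)) + ∑ i, (ζ i).re * x i) =
        (8 * (Real.pi * √Real.pi) * (s * √s)) * Real.exp (s * ∑ i, (ζ i).re ^ 2) := by
      apply ofReal_injective; rw [h]; push_cast; rfl
    have e2 : ∀ x : E3, ‖F s x‖ = (Real.exp (-(μ ^ 2 * s)) / (s * √s)) *
        Real.exp (-(‖x‖ ^ 2 / (4 * s)) + ∑ i, (ζ i).re * x i) := by
      intro x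
      rw [hFeq, norm_mul, Complex.norm_exp, Complex.norm_real, Real.norm_of_nonneg (by positivity)]
      congr 2
      simp only [add_re, neg_re, ofReal_re, re_sum, re_mul_ofReal]
    simp_rw [e2]
    rw [integral_const_mul, h']
    have h1 : 0 < √s := Real.sqrt_pos.2 hs
    rw [show -(μ ^ 2 - ∑ i, (ζ i).re ^ 2) * s = -(μ ^ 2 * s) + s * ∑ i, (ζ i).re ^ 2 by ring,
      Real.exp_add]
    field_simp
  have hmeas : Measurable (Function.uncurry F) := by
    rw [hF]; unfold Function.uncurry
    fun_prop
  have hint : Integrable (Function.uncurry F) (J.prod (volume : Measure E3)) := by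
    rw [integrable_prod_iff hmeas.aestronglyMeasurable]
    constructor
    · filter_upwards [ae_restrict_mem measurableSet_Ioi] with s hs
      simp only [Function.uncurry]
      simp_rw [hFeq]
      exact (integrable_gaussian_mul_cexp hs ζ).const_mul _
    · have h1 : IntegrableOn (fun s => (8 * (Real.pi * √Real.pi) : ℝ) *
          Real.exp (-(μ ^ 2 - ∑ i, (ζ i).re ^ 2) * s)) (Ioi 0) :=
        (integrableOn_exp_mul_Ioi (by linarith) 0).const_mul _
      refine h1.congr ?_
      filter_upwards [ae_restrict_mem measurableSet_Ioi] with s hs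
      exact (hFn s hs).symm
  have hswap := integral_integral_swap hint
  have hL : ∫ s, ∫ x, F s x ∂volume ∂J = (8 * (Real.pi * √Real.pi) : ℝ) *
      (1 / (μ ^ 2 - ∑ i, ζ i ^ 2)) := by
    have : ∫ s, ∫ x, F s x ∂volume ∂J = ∫ s in Ioi (0 : ℝ), (8 * (Real.pi * √Real.pi) : ℝ) *
      cexp (-(μ ^ 2 - ∑ i, ζ i ^ 2) * s) := setIntegral_congr_fun measurableSet_Ioi
        fun s hs => hFi s hs
    rw [this, integral_const_mul, integral_exp_mul_complex_Ioi]
    · simp only [ofReal_zero, mul_zero, Complex.exp_zero, neg_div_neg_eq]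
    · have h3 : (∑ i, (ζ i) ^ 2).re ≤ ∑ i, (ζ i).re ^ 2 := by
        rw [re_sum]
        refine Finset.sum_le_sum fun i _ => ?_
        rw [sq, mul_re]; nlinarith [sq_nonneg (ζ i).im]
      have h4 : ((μ : ℂ) ^ 2).re = μ ^ 2 := by norm_cast
      rw [neg_re, sub_re, h4]
      linarith
  have hR : ∫ x, ∫ s, F s x ∂J = (2 * √Real.pi : ℝ) *
      ∫ x : E3, cexp (-μ * ‖x‖) / ‖x‖ * cexp (∑ i, ζ i * x i) := by
    rw [← integral_const_mul]
    refine integral_congr_ae ?_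
    have h0 : ∀ᵐ x : E3, x ≠ 0 := by
      simp [ae_iff]
    filter_upwards [h0] with x hx
    have hx' : 0 < ‖x‖ := norm_pos_iff.2 hx
    rw [hF]
    simp only
    rw [integral_mul_const, integral_complex_ofReal, (integral_exp_div_mul_sqrt hx' hμ).2]
    push_cast
    ring
  rw [hL, hR] at hswap
  have hne : (μ : ℂ) ^ 2 - ∑ i, ζ i ^ 2 ≠ 0 := by
    intro h
    have h3 : (∑ i, (ζ i) ^ 2).re ≤ ∑ i, (ζ i).re ^ 2 := by
      rw [re_sum]
      refine Finset.sum_le_sum fun i _ => ?_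
      rw [sq, mul_re]; nlinarith [sq_nonneg (ζ i).im]
    have h4 : ((μ : ℂ) ^ 2).re = μ ^ 2 := by norm_cast
    have := congrArg Complex.re h
    rw [sub_re, h4, zero_re] at this
    linarith
  have hpi : ((√Real.pi : ℝ) : ℂ) ≠ 0 := ofReal_ne_zero.2 (Real.sqrt_pos.2 Real.pi_pos).ne'
  generalize (∫ x : E3, cexp (-μ * ‖x‖) / ‖x‖ * cexp (∑ i, ζ i * x i)) = I at hswap ⊢
  push_cast at hswap
  field_simp at hswap
  linear_combination (-1 / 2) * hswap

lemma measurable_yukawa (μ : ℂ) (ζ : Fin 3 → ℂ) :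
    Measurable fun x : E3 => cexp (-μ * ‖x‖) / ‖x‖ * cexp (∑ i, ζ i * x i) := by
  fun_prop

lemma norm_yukawa_le {a : ℝ} {ζ : Fin 3 → ℂ} (ha : ∀ x : E3, ∑ i, (ζ i).re * x i ≤ a * ‖x‖)
    (μ : ℂ) (x : E3) :
    ‖cexp (-μ * ‖x‖) / ‖x‖ * cexp (∑ i, ζ i * x i)‖ ≤
      ‖x‖⁻¹ * Real.exp (-((μ.re - a) * ‖x‖)) := by
  rw [norm_mul, norm_cexp_sum, norm_div, Complex.norm_exp, Complex.norm_real, norm_norm,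
    div_eq_inv_mul, mul_assoc, ← Real.exp_add]
  gcongr
  simp only [re_mul_ofReal, neg_re]
  linarith [ha x]

lemma integrable_yukawa {a : ℝ} {ζ : Fin 3 → ℂ} (ha : ∀ x : E3, ∑ i, (ζ i).re * x i ≤ a * ‖x‖)
    {μ : ℂ} (hμ : a < μ.re) :
    Integrable fun x : E3 => cexp (-μ * ‖x‖) / ‖x‖ * cexp (∑ i, ζ i * x i) := by
  have h := integrable_norm_rpow_mul_exp (s := 1) (by norm_num) (sub_pos.2 hμ)
  refine h.mono' (measurable_yukawa μ ζ).aestronglyMeasurable (Eventually.of_forall fun x => ?_)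
  rw [Real.rpow_neg_one]
  exact norm_yukawa_le ha μ x

/-- The Fourier–Laplace transform of the Yukawa potential with complex mass. -/
theorem yukawa_fourier {a : ℝ} (ha0 : 0 ≤ a) {ζ : Fin 3 → ℂ}
    (ha : ∀ x : E3, ∑ i, (ζ i).re * x i ≤ a * ‖x‖) (ha2 : ∑ i, (ζ i).re ^ 2 ≤ a ^ 2)
    {μ : ℂ} (hμ : a < μ.re) :
    (∫ x : E3, cexp (-μ * ‖x‖) / ‖x‖ * cexp (∑ i, ζ i * x i)) * (μ ^ 2 - ∑ i, ζ i ^ 2) =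
      4 * Real.pi := by
  set U : Set ℂ := {μ | a < μ.re} with hU
  have hUo : IsOpen U := isOpen_lt continuous_const continuous_re
  set F : ℂ → ℂ := fun μ => ∫ x : E3, cexp (-μ * ‖x‖) / ‖x‖ * cexp (∑ i, ζ i * x i) with hF
  have hdiff : DifferentiableOn ℂ F U := by
    intro μ₀ hμ₀
    have hμ₀ : a < μ₀.re := hμ₀
    -- Differentiating in μ cancels the factor 1/‖x‖, so near μ₀ the derivative is dominated by a
    -- pure exponential whose rate `b - a` is positive.
    set b := (a + μ₀.re) / 2 with hb
    set s : Set ℂ := {μ | b < μ.re} with hs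
    have hs' : s ∈ 𝓝 μ₀ := (isOpen_lt continuous_const continuous_re).mem_nhds (by
      change b < μ₀.re; linarith)
    have hbd := integrable_norm_rpow_mul_exp (s := 0) (c := b - a) (by norm_num) (by linarith)
    have := hasDerivAt_integral_of_dominated_loc_of_deriv_le (μ := (volume : Measure E3))
      (F := fun μ (x : E3) => cexp (-μ * ‖x‖) / ‖x‖ * cexp (∑ i, ζ i * x i))
      (F' := fun μ (x : E3) => cexp (-μ * ‖x‖) * (-1 * ‖x‖) / ‖x‖ * cexp (∑ i, ζ i * x i))
      (bound := fun x : E3 => ‖x‖ ^ (-(0 : ℝ)) * Real.exp (-((b - a) * ‖x‖))) hs'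
      (Eventually.of_forall fun μ => (measurable_yukawa μ ζ).aestronglyMeasurable)
      (integrable_yukawa ha hμ₀)
      (by refine Measurable.aestronglyMeasurable ?_; fun_prop)
      (Eventually.of_forall fun x μ hμ => by
        have hμ : b < μ.re := hμ
        rcases eq_or_ne x 0 with rfl | hx
        · simp
        have hx' : 0 < ‖x‖ := norm_pos_iff.2 hx
        have h1 := norm_yukawa_le ha μ x
        have e : cexp (-μ * ‖x‖) * (-1 * ‖x‖) / ‖x‖ * cexp (∑ i, ζ i * x i) =
          (-‖x‖ : ℂ) * (cexp (-μ * ‖x‖) / ‖x‖ * cexp (∑ i, ζ i * x i)) := by ring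
        rw [e, norm_mul, norm_neg, Complex.norm_real, norm_norm, neg_zero, Real.rpow_zero, one_mul]
        calc _ ≤ ‖x‖ * (‖x‖⁻¹ * Real.exp (-((μ.re - a) * ‖x‖))) := by gcongr
          _ = Real.exp (-((μ.re - a) * ‖x‖)) := by field_simp
          _ ≤ _ := by gcongr)
      hbd
      (Eventually.of_forall fun x μ _ => by
        have h1 : HasDerivAt (fun μ : ℂ => -μ * ‖x‖) (-1 * ‖x‖) μ :=
          ((hasDerivAt_id μ).neg).mul_const _
        exact ((h1.cexp).div_const _).mul_const _)
    exact this.2.differentiableAt.differentiableWithinAt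
  -- The identity theorem extends the formula from the real half-line to the half-plane. In product
  -- form no zero of μ² - Σζᵢ² has to be excluded.
  have hA1 : AnalyticOnNhd ℂ (fun μ => F μ * (μ ^ 2 - ∑ i, ζ i ^ 2)) U := by
    refine DifferentiableOn.analyticOnNhd ?_ hUo
    exact hdiff.mul (by fun_prop)
  have hA2 : AnalyticOnNhd ℂ (fun _ => (4 * Real.pi : ℂ)) U := analyticOnNhd_const
  have hpre : IsPreconnected U := (convex_halfSpace_re_gt a).isPreconnected
  have hreal : ∀ y : ℝ, a < y → F y * ((y : ℂ) ^ 2 - ∑ i, ζ i ^ 2) = 4 * Real.pi := by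
    intro y hy
    refine yukawa_fourier_real (by linarith) (lt_of_le_of_lt ha2 ?_)
    gcongr
  have hz : (((a + 1 : ℝ) : ℂ)) ∈ U := by simp [hU]
  have hfreq : ∃ᶠ z in 𝓝[≠] (((a + 1 : ℝ) : ℂ)),
      F z * (z ^ 2 - ∑ i, ζ i ^ 2) = 4 * Real.pi := by
    have ht : Tendsto (fun y : ℝ => (y : ℂ)) (𝓝[>] (a + 1)) (𝓝[≠] (((a + 1 : ℝ) : ℂ))) := by
      refine tendsto_nhdsWithin_iff.2
        ⟨(continuous_ofReal.tendsto _).mono_left nhdsWithin_le_nhds, ?_⟩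
      filter_upwards [self_mem_nhdsWithin] with y hy
      have hy : a + 1 < y := hy
      simp only [mem_compl_iff, mem_singleton_iff, ofReal_inj]
      exact hy.ne'
    refine ht.frequently (Eventually.frequently ?_)
    filter_upwards [self_mem_nhdsWithin] with y hy
    have hy : a + 1 < y := hy
    exact hreal y (by linarith)
  exact hA1.eqOn_of_preconnected_of_frequently_eq hA2 hpre hz hfreq hμ

/-! ### Complex masses: spectral gap and differences. -/

/-- The real part of the square root of `a² + i s`. -/
def massRe (a s : ℝ) : ℝ := √((√(a ^ 4 + s ^ 2) + a ^ 2) / 2)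

/-- The square root of `a² + i s` with positive real part. -/
def mass (a s : ℝ) : ℂ := ⟨massRe a s, s / (2 * massRe a s)⟩

lemma massRe_sq (a s : ℝ) : massRe a s ^ 2 = (√(a ^ 4 + s ^ 2) + a ^ 2) / 2 :=
  Real.sq_sqrt (by positivity)

lemma massRe_pos {a : ℝ} (ha : 0 < a) (s : ℝ) : 0 < massRe a s :=
  Real.sqrt_pos.2 (by positivity)

lemma mass_sq {a : ℝ} (ha : 0 < a) (s : ℝ) : mass a s ^ 2 = (a ^ 2 : ℝ) + I * s := by
  have h1 := massRe_sq a s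
  have h2 := massRe_pos ha s
  have h3 : √(a ^ 4 + s ^ 2) ^ 2 = a ^ 4 + s ^ 2 := Real.sq_sqrt (by positivity)
  generalize √(a ^ 4 + s ^ 2) = ρ at *
  apply Complex.ext
  · simp only [sq, mul_re, mass, add_re, ofReal_re, I_re, ofReal_im, I_im]
    field_simp
    have : s ^ 2 = ρ ^ 2 - a ^ 4 := by linarith
    rw [this, show massRe a s ^ 4 = (massRe a s ^ 2) ^ 2 by ring, h1]
    ring
  · simp only [sq, mul_im, mass, add_im, ofReal_re, I_re, ofReal_im, I_im]
    field_simp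
    ring

lemma norm_mass_sq_le {a : ℝ} (ha : 0 < a) (s : ℝ) : ‖mass a s‖ ^ 2 ≤ a ^ 2 + |s| := by
  rw [← norm_pow, mass_sq ha]
  refine (norm_add_le _ _).trans ?_
  rw [norm_mul, norm_I, one_mul, Complex.norm_real, Complex.norm_real, Real.norm_eq_abs,
    Real.norm_eq_abs, abs_of_nonneg (sq_nonneg a)]

lemma one_le_abs_intCast {k : ℤ} (hk : k ≠ 0) : (1 : ℝ) ≤ |(k : ℝ)| := by
  have := Int.one_le_abs hk
  exact_mod_cast this

/-- Twice the square of the real part is |μ²| + a², and |μ²| = √(a⁴ + ϖ²k²) exceeds a² by a multiple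
of |k|. The summand `a` will absorb the drift; c√|k| is the decay that remains. -/
lemma exists_massRe_ge {a ϖ : ℝ} (ha : 0 < a) (hϖ : 0 < ϖ) :
    ∃ c > 0, ∀ k : ℤ, k ≠ 0 → a + c * √|(k : ℝ)| ≤ massRe a (ϖ * k) := by
  -- Chosen so that (a² + 2dn)² ≤ a⁴ + ϖ²n² for n ≥ 1; the constant `c` below then satisfies (a +
  -- c√n)² ≤ a² + dn.
  set d : ℝ := min 1 (ϖ ^ 2 / (4 * a ^ 2 + 4)) with hd
  have hd0 : 0 < d := by positivity
  have hd1 : d ≤ 1 := min_le_left _ _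
  have hd2 : d * (4 * a ^ 2 + 4) ≤ ϖ ^ 2 := by
    rw [← le_div_iff₀ (by positivity)]; exact min_le_right _ _
  set c : ℝ := min 1 (d / (2 * a + 1)) with hc
  have hc0 : 0 < c := by positivity
  have hc1 : c ≤ 1 := min_le_left _ _
  have hc2 : c * (2 * a + 1) ≤ d := by
    rw [← le_div_iff₀ (by positivity)]; exact min_le_right _ _
  refine ⟨c, hc0, fun k hk => ?_⟩
  have hk1 := one_le_abs_intCast hk
  set n : ℝ := |(k : ℝ)| with hn
  have hkn : (ϖ * (k : ℝ)) ^ 2 = ϖ ^ 2 * n ^ 2 := by rw [mul_pow, hn, sq_abs]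
  have h1 : a ^ 2 + 2 * d * n ≤ √(a ^ 4 + (ϖ * k) ^ 2) := by
    apply Real.le_sqrt_of_sq_le
    rw [hkn]
    have h2 : n ≤ n ^ 2 := by nlinarith
    have h3 : d ^ 2 ≤ d := by nlinarith
    have h4 : d * (4 * a ^ 2) * n ≤ d * (4 * a ^ 2) * n ^ 2 := by gcongr
    have h5 : d ^ 2 * n ^ 2 ≤ d * n ^ 2 := by gcongr
    have h6 : d * (4 * a ^ 2 + 4) * n ^ 2 ≤ ϖ ^ 2 * n ^ 2 := by gcongr
    nlinarith
  apply Real.le_sqrt_of_sq_le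
  have h7 : √n ^ 2 = n := Real.sq_sqrt (by positivity)
  have h8 : 1 ≤ √n := Real.one_le_sqrt.2 hk1
  have h9 : √n ≤ n := by nlinarith
  have h10 : 2 * a * c * √n ≤ 2 * a * c * n := by gcongr
  have h11 : c ^ 2 * n ≤ c * n := by
    have : c ^ 2 ≤ c := by nlinarith
    gcongr
  have h12 : c * (2 * a + 1) * n ≤ d * n := by gcongr
  nlinarith

lemma exists_norm_mass_le {a ϖ : ℝ} (ha : 0 < a) (hϖ : 0 < ϖ) :
    ∃ M > 0, ∀ k : ℤ, k ≠ 0 → ‖mass a (ϖ * k)‖ ≤ M * √|(k : ℝ)| := by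
  refine ⟨√(a ^ 2 + ϖ), Real.sqrt_pos.2 (by positivity), fun k hk => ?_⟩
  have hk1 := one_le_abs_intCast hk
  rw [← Real.sqrt_mul (by positivity)]
  apply Real.le_sqrt_of_sq_le
  refine (norm_mass_sq_le ha _).trans ?_
  rw [abs_mul, abs_of_pos hϖ]
  nlinarith [sq_nonneg a]

/-- The difference of the squares is iϖ, and the sum of the masses has real part at least c√|k|. For
the index `l` only positivity of the real part enters, so `l = 0` is allowed. -/
lemma norm_mass_sub_le {a ϖ c : ℝ} (ha : 0 < a) (hϖ : 0 < ϖ) (hc : 0 < c)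
    (h : ∀ k : ℤ, k ≠ 0 → a + c * √|(k : ℝ)| ≤ massRe a (ϖ * k)) {k : ℤ} (hk : k ≠ 0) (l : ℤ)
    (hl : l = k - 1) :
    ‖mass a (ϖ * k) - mass a (ϖ * l)‖ ≤ ϖ / c / √|(k : ℝ)| := by
  have hk1 := one_le_abs_intCast hk
  have hprod : (mass a (ϖ * k) - mass a (ϖ * l)) * (mass a (ϖ * k) + mass a (ϖ * l)) = I * ϖ := by
    have h1 := mass_sq ha (ϖ * k)
    have h2 := mass_sq ha (ϖ * l)
    subst hl
    push_cast at h1 h2 ⊢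
    linear_combination h1 - h2
  have hn : ‖mass a (ϖ * k) - mass a (ϖ * l)‖ * ‖mass a (ϖ * k) + mass a (ϖ * l)‖ = ϖ := by
    rw [← norm_mul, hprod, norm_mul, norm_I, one_mul, Complex.norm_real,
      Real.norm_of_nonneg hϖ.le]
  have hge : c * √|(k : ℝ)| ≤ ‖mass a (ϖ * k) + mass a (ϖ * l)‖ := by
    refine le_trans ?_ (Complex.re_le_norm _)
    have h3 := massRe_pos ha (ϖ * l)
    have h4 := h k hk
    simp only [add_re, mass]
    linarith
  have hs : 0 < √|(k : ℝ)| := Real.sqrt_pos.2 (by linarith)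
  rw [div_div, le_div_iff₀ (by positivity)]
  calc _ ≤ ‖mass a (ϖ * k) - mass a (ϖ * l)‖ * ‖mass a (ϖ * k) + mass a (ϖ * l)‖ := by gcongr
    _ = ϖ := hn

/-! ### Pointwise bounds for the modes and their differences in k. -/

/-- Mean value inequality on a half-plane, which is convex and on which the derivative of exp is
bounded by exp R. -/
lemma norm_cexp_sub_cexp_le {z w : ℂ} {R : ℝ} (hz : z.re ≤ R) (hw : w.re ≤ R) :
    ‖cexp z - cexp w‖ ≤ Real.exp R * ‖z - w‖ := by
  refine Convex.norm_image_sub_le_of_norm_deriv_le (f := cexp) (s := {z | z.re ≤ R})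
    (fun x _ => differentiableAt_exp) (fun x hx => ?_) (convex_halfSpace_re_le R) hw hz
  rw [Complex.deriv_exp, Complex.norm_exp]
  exact Real.exp_le_exp.2 hx

/-- The exponential factor of the `k`-th mode. -/
def modeExp (a ϖ : ℝ) (k : ℤ) (x : E3) : ℂ := cexp (-mass a (ϖ * k) * ‖x‖ - a * x 0)

/-- The `k`-th Fourier mode in time of the purely periodic fundamental solution. -/
def mode (a ϖ : ℝ) (k : ℤ) (x : E3) : ℂ :=
  if k = 0 then 0 else (((4 * Real.pi * ‖x‖ : ℝ) : ℂ))⁻¹ * modeExp a ϖ k x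

/-- The partial derivative `∂_j` of the `k`-th mode away from the origin. -/
def gradMode (a ϖ : ℝ) (j : Fin 3) (k : ℤ) (x : E3) : ℂ :=
  mode a ϖ k x * ((-(if j = 0 then a else 0) - x j / ‖x‖ ^ 2 : ℝ) -
    mass a (ϖ * k) * (x j / ‖x‖ : ℝ))

/-- Families of modes with the singularity at the origin and the decay which the estimates need. -/
structure IsAdmissible (m : ℕ) (b C : ℝ) (Q : ℤ → E3 → ℂ) : Prop where
  b_pos : 0 < b
  C_nonneg : 0 ≤ C
  zero : ∀ x, Q 0 x = 0
  cont : ∀ k, ContinuousOn (Q k) {0}ᶜ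
  bound : ∀ (k : ℤ) (x : E3), k ≠ 0 → x ≠ 0 →
    ‖Q k x‖ ≤ C / ‖x‖ ^ (m + 1) * Real.exp (-(b * √|(k : ℝ)| * ‖x‖))
  diff : ∀ (k : ℤ) (x : E3), k ≠ 0 → k ≠ 1 → x ≠ 0 →
    ‖Q k x - Q (k - 1) x‖ ≤
      C / ‖x‖ ^ m * (Real.exp (-(b * √|(k : ℝ)| * ‖x‖)) / √|(k : ℝ)|)

lemma abs_coord_le (x : E3) (j : Fin 3) : |x j| ≤ ‖x‖ := by
  simpa using PiLp.norm_apply_le x j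

/-- The drift contributes at most a‖x‖, exactly what the summand `a` in the gap pays for. -/
lemma modeExp_exponent_re_le {a ϖ c : ℝ} (ha : 0 < a)
    (h : ∀ k : ℤ, k ≠ 0 → a + c * √|(k : ℝ)| ≤ massRe a (ϖ * k)) {k : ℤ} (hk : k ≠ 0) (x : E3) :
    (-mass a (ϖ * k) * ‖x‖ - a * x 0 : ℂ).re ≤ -(c * √|(k : ℝ)| * ‖x‖) := by
  have h1 : (-mass a (ϖ * k) * ‖x‖ - a * x 0 : ℂ).re = -massRe a (ϖ * k) * ‖x‖ - a * x 0 := by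
    rw [sub_re, re_mul_ofReal, neg_re, ← ofReal_mul, ofReal_re]; rfl
  rw [h1]
  have h2 := mul_le_mul_of_nonneg_right (h k hk) (norm_nonneg x)
  have h3 := abs_coord_le x 0
  have h4 := neg_abs_le (x 0)
  nlinarith

lemma continuousOn_mode (a ϖ : ℝ) (k : ℤ) : ContinuousOn (mode a ϖ k) {0}ᶜ := by
  unfold mode modeExp
  split_ifs with h
  · exact continuousOn_const
  · refine ContinuousOn.mul ?_ (by fun_prop)
    refine ContinuousOn.inv₀ (by fun_prop) fun x hx => ?_
    have : ‖x‖ ≠ 0 := norm_ne_zero_iff.2 hx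
    have := Real.pi_ne_zero
    exact ofReal_ne_zero.2 (by positivity)

lemma continuousOn_gradMode (a ϖ : ℝ) (j : Fin 3) (k : ℤ) :
    ContinuousOn (gradMode a ϖ j k) {0}ᶜ := by
  have hne : ∀ x ∈ ({0}ᶜ : Set E3), ‖x‖ ≠ 0 := fun x hx => norm_ne_zero_iff.2 hx
  refine (continuousOn_mode a ϖ k).mul (ContinuousOn.sub ?_ (continuousOn_const.mul ?_))
  · refine continuous_ofReal.comp_continuousOn (continuousOn_const.sub ?_)
    exact ContinuousOn.div (by fun_prop) (by fun_prop) fun x hx => pow_ne_zero _ (hne x hx)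
  · refine continuous_ofReal.comp_continuousOn ?_
    exact ContinuousOn.div (by fun_prop) (by fun_prop) hne

/-- The gap gives the size, `norm_mass_sub_le` the differences. In the gradient the factor μ_k grows
like √|k|; it is bounded by ‖x‖⁻¹ at the expense of part of the exponential. -/
theorem exists_isAdmissible {a ϖ : ℝ} (ha : 0 < a) (hϖ : 0 < ϖ) :
    ∃ b C : ℝ, IsAdmissible 0 b C (mode a ϖ) ∧ ∀ j, IsAdmissible 1 b C (gradMode a ϖ j) := by
  obtain ⟨c, hc, hgap⟩ := exists_massRe_ge ha hϖ
  obtain ⟨M, hM, hmass⟩ := exists_norm_mass_le ha hϖ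
  -- One factor 2 is lost in passing from √|k - 1| to √|k|, the other is spent on the growth of μ_k
  -- in `hfac`.
  obtain ⟨b, hb⟩ : ∃ y : ℝ, y = c / 4 := ⟨_, rfl⟩
  have hb0 : 0 < b := by rw [hb]; positivity
  obtain ⟨K, hK⟩ : ∃ y : ℝ, y = ϖ / c := ⟨_, rfl⟩
  have hK0 : 0 < K := by rw [hK]; positivity
  obtain ⟨K', hK'⟩ : ∃ y : ℝ, y = 1 + (a + M) / b := ⟨_, rfl⟩
  have hK'0 : 0 < K' := by rw [hK']; positivity
  -- Dominates the four constants 1, K, K' and KK' + K of the bounds and difference bounds for the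
  -- modes and their gradients.
  obtain ⟨C, hC⟩ : ∃ y : ℝ, y = 1 + K + K' + K * K' := ⟨_, rfl⟩
  have hC0 : 0 ≤ C := by rw [hC]; positivity
  -- half of the decay suffices for both indices `k` and `k - 1`
  have hre : ∀ (k : ℤ) (x : E3), k ≠ 0 → (-mass a (ϖ * k) * ‖x‖ - a * x 0 : ℂ).re ≤
      -(2 * b * √|(k : ℝ)| * ‖x‖) := by
    intro k x hk
    refine (modeExp_exponent_re_le ha hgap hk x).trans ?_
    rw [neg_le_neg_iff]
    gcongr
    rw [hb]; linarith
  have hre' : ∀ (k : ℤ) (x : E3), k ≠ 0 → k ≠ 1 → (-mass a (ϖ * (k - 1 : ℤ)) * ‖x‖ - a * x 0 : ℂ).re ≤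
      -(2 * b * √|(k : ℝ)| * ‖x‖) := by
    intro k x hk hk1
    refine (modeExp_exponent_re_le ha hgap (sub_ne_zero.2 hk1) x).trans ?_
    rw [neg_le_neg_iff]
    have h1 : |(k : ℝ)| ≤ 4 * |((k - 1 : ℤ) : ℝ)| := by
      have h2 := one_le_abs_intCast (sub_ne_zero.2 hk1)
      have h3 : |(k : ℝ)| ≤ |((k - 1 : ℤ) : ℝ)| + 1 := by
        calc |(k : ℝ)| = |((k - 1 : ℤ) : ℝ) + 1| := by push_cast; ring_nf
          _ ≤ _ := (abs_add_le _ _).trans (by simp)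
      linarith
    have h4 : √|(k : ℝ)| ≤ 2 * √|((k - 1 : ℤ) : ℝ)| := by
      refine (Real.sqrt_le_sqrt h1).trans ?_
      rw [Real.sqrt_mul (by norm_num), show (4 : ℝ) = 2 ^ 2 by norm_num,
        Real.sqrt_sq (by norm_num)]
    calc 2 * b * √|(k : ℝ)| * ‖x‖ ≤ 2 * b * (2 * √|((k - 1 : ℤ) : ℝ)|) * ‖x‖ := by gcongr
      _ = _ := by rw [hb]; ring
  have hE : ∀ (k : ℤ) (x : E3), k ≠ 0 → ‖modeExp a ϖ k x‖ ≤ Real.exp (-(2 * b * √|(k : ℝ)| * ‖x‖)) := by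
    intro k x hk
    rw [modeExp, Complex.norm_exp]; exact Real.exp_le_exp.2 (hre k x hk)
  have hE' : ∀ (k : ℤ) (x : E3), k ≠ 0 → k ≠ 1 →
      ‖modeExp a ϖ (k - 1) x‖ ≤ Real.exp (-(2 * b * √|(k : ℝ)| * ‖x‖)) := by
    intro k x hk hk1
    rw [modeExp, Complex.norm_exp]; exact Real.exp_le_exp.2 (hre' k x hk hk1)
  have hmd : ∀ k : ℤ, k ≠ 0 → ‖mass a (ϖ * k) - mass a (ϖ * (k - 1 : ℤ))‖ ≤ K / √|(k : ℝ)| :=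
    fun k hk => hK ▸ norm_mass_sub_le ha hϖ hc hgap hk _ rfl
  have hEd : ∀ (k : ℤ) (x : E3), k ≠ 0 → k ≠ 1 → ‖modeExp a ϖ k x - modeExp a ϖ (k - 1) x‖ ≤
      K * ‖x‖ * (Real.exp (-(2 * b * √|(k : ℝ)| * ‖x‖)) / √|(k : ℝ)|) := by
    intro k x hk hk1
    refine (norm_cexp_sub_cexp_le (hre k x hk) (hre' k x hk hk1)).trans ?_
    have e : (-mass a (ϖ * k) * ‖x‖ - a * x 0 : ℂ) - (-mass a (ϖ * (k - 1 : ℤ)) * ‖x‖ - a * x 0)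
        = -(mass a (ϖ * k) - mass a (ϖ * (k - 1 : ℤ))) * ‖x‖ := by ring
    rw [e, norm_mul, norm_neg, Complex.norm_real, norm_norm]
    calc _ ≤ Real.exp (-(2 * b * √|(k : ℝ)| * ‖x‖)) * (K / √|(k : ℝ)| * ‖x‖) := by
          gcongr; exact hmd k hk
      _ = _ := by ring
  have hpi : (4 * Real.pi)⁻¹ ≤ 1 := inv_le_one_of_one_le₀ (by linarith [Real.pi_gt_three])
  have hweak : ∀ (k : ℤ) (x : E3), Real.exp (-(2 * b * √|(k : ℝ)| * ‖x‖)) ≤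
      Real.exp (-(b * √|(k : ℝ)| * ‖x‖)) := by
    intro k x
    gcongr
    linarith
  have hpre : ∀ x : E3, x ≠ 0 → ‖(((4 * Real.pi * ‖x‖ : ℝ) : ℂ))⁻¹‖ ≤ 1 / ‖x‖ := by
    intro x hx
    have : 0 < ‖x‖ := norm_pos_iff.2 hx
    rw [norm_inv, Complex.norm_real, Real.norm_of_nonneg (by positivity), mul_inv, one_div]
    exact mul_le_of_le_one_left (by positivity) hpi
  refine ⟨b, C, ⟨hb0, hC0, fun x => by simp [mode], continuousOn_mode a ϖ, ?_, ?_⟩,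
    fun j => ⟨hb0, hC0, fun x => by simp [gradMode, mode], continuousOn_gradMode a ϖ j, ?_, ?_⟩⟩
  · intro k x hk hx
    have hx' : 0 < ‖x‖ := norm_pos_iff.2 hx
    rw [mode, if_neg hk, norm_mul]
    calc _ ≤ 1 / ‖x‖ * Real.exp (-(b * √|(k : ℝ)| * ‖x‖)) := by
          gcongr
          · exact hpre x hx
          · exact (hE k x hk).trans (hweak k x)
      _ ≤ _ := by
        rw [zero_add, pow_one]
        gcongr
        rw [hC]
        have : 0 < K * K' := by positivity
        linarith
  · intro k x hk hk1 hx
    have hx' : 0 < ‖x‖ := norm_pos_iff.2 hx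
    rw [mode, mode, if_neg hk, if_neg (sub_ne_zero.2 hk1), ← mul_sub, norm_mul]
    calc _ ≤ 1 / ‖x‖ * (K * ‖x‖ * (Real.exp (-(b * √|(k : ℝ)| * ‖x‖)) / √|(k : ℝ)|)) := by
          gcongr
          · exact hpre x hx
          · refine (hEd k x hk hk1).trans ?_
            gcongr K * ‖x‖ * (?_ / _)
            exact hweak k x
      _ = K * (Real.exp (-(b * √|(k : ℝ)| * ‖x‖)) / √|(k : ℝ)|) := by field_simp
      _ ≤ _ := by
        rw [pow_zero, div_one]
        gcongr
        rw [hC]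
        have : 0 < K * K' := by positivity
        linarith
  all_goals
    have hB : ∀ x : E3, x ≠ 0 → |x j / ‖x‖| ≤ 1 := by
      intro x hx
      have hx' : 0 < ‖x‖ := norm_pos_iff.2 hx
      rw [abs_div, abs_norm, div_le_one hx']; exact abs_coord_le x j
    have hA : ∀ x : E3, x ≠ 0 → |-(if j = 0 then a else 0) - x j / ‖x‖ ^ 2| ≤ a + 1 / ‖x‖ := by
      intro x hx
      have hx' : 0 < ‖x‖ := norm_pos_iff.2 hx
      refine (abs_sub _ _).trans ?_
      gcongr
      · rw [abs_neg]; split_ifs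
        · exact (abs_of_pos ha).le
        · simpa using ha.le
      · rw [sq, ← div_div, abs_div, abs_norm]
        gcongr
        exact hB x hx
    -- With y = b√|k|‖x‖, the term (a + M)√|k| is ((a + M)/b) y/‖x‖, and y + 1 ≤ exp y turns the
    -- growth in k into an exponential that half of the decay cancels.
    have hfac : ∀ (k : ℤ) (x : E3), k ≠ 0 → x ≠ 0 →
        ‖((-(if j = 0 then a else 0) - x j / ‖x‖ ^ 2 : ℝ) -
          mass a (ϖ * k) * (x j / ‖x‖ : ℝ) : ℂ)‖ ≤
          K' / ‖x‖ * Real.exp (b * √|(k : ℝ)| * ‖x‖) := by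
      intro k x hk hx
      have hx' : 0 < ‖x‖ := norm_pos_iff.2 hx
      have hk1 : 1 ≤ √|(k : ℝ)| := Real.one_le_sqrt.2 (one_le_abs_intCast hk)
      set n := √|(k : ℝ)| with hn
      refine (norm_sub_le _ _).trans ?_
      rw [norm_mul, Complex.norm_real, Complex.norm_real, Real.norm_eq_abs, Real.norm_eq_abs]
      have h1 : b * n * ‖x‖ + 1 ≤ Real.exp (b * n * ‖x‖) := Real.add_one_le_exp _
      have h2 : (1 : ℝ) ≤ Real.exp (b * n * ‖x‖) := Real.one_le_exp (by positivity)
      calc _ ≤ (a + 1 / ‖x‖) + M * n * 1 := by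
            gcongr
            · exact hA x hx
            · exact hmass k hk
            · exact hB x hx
        _ ≤ (a * n + 1 / ‖x‖) + M * n * 1 := by
            gcongr
            exact le_mul_of_one_le_right ha.le hk1
        _ = (1 + (a + M) / b * (b * n * ‖x‖)) / ‖x‖ := by field_simp; ring
        _ ≤ (Real.exp (b * n * ‖x‖) + (a + M) / b * Real.exp (b * n * ‖x‖)) / ‖x‖ := by
            gcongr
            linarith
        _ = _ := by rw [hK']; ring
    have hexp : ∀ (k : ℤ) (x : E3), Real.exp (-(2 * b * √|(k : ℝ)| * ‖x‖)) *
        Real.exp (b * √|(k : ℝ)| * ‖x‖) = Real.exp (-(b * √|(k : ℝ)| * ‖x‖)) := by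
      intro k x
      rw [← Real.exp_add]; congr 1; ring
  · intro k x hk hx
    have hx' : 0 < ‖x‖ := norm_pos_iff.2 hx
    rw [gradMode, mode, if_neg hk, norm_mul, norm_mul]
    calc _ ≤ 1 / ‖x‖ * Real.exp (-(2 * b * √|(k : ℝ)| * ‖x‖)) *
          (K' / ‖x‖ * Real.exp (b * √|(k : ℝ)| * ‖x‖)) := by
          gcongr
          · exact hpre x hx
          · exact hE k x hk
          · exact hfac k x hk hx
      _ = K' / ‖x‖ ^ (1 + 1) * (Real.exp (-(2 * b * √|(k : ℝ)| * ‖x‖)) *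
          Real.exp (b * √|(k : ℝ)| * ‖x‖)) := by field_simp
      _ ≤ _ := by
        rw [hexp]
        gcongr
        rw [hC]
        have : 0 < K * K' := by positivity
        linarith
  · intro k x hk hk1 hx
    have hx' : 0 < ‖x‖ := norm_pos_iff.2 hx
    have hkn : 0 < √|(k : ℝ)| := Real.sqrt_pos.2 (by linarith [one_le_abs_intCast hk])
    set A : ℂ := ((-(if j = 0 then a else 0) - x j / ‖x‖ ^ 2 : ℝ) : ℂ) with hAdef
    set B : ℂ := ((x j / ‖x‖ : ℝ) : ℂ) with hBdef
    -- Discrete product rule: either the exponential or the mass is differenced, and each case gains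
    -- 1/√|k|.
    have e : gradMode a ϖ j k x - gradMode a ϖ j (k - 1) x =
        (((4 * Real.pi * ‖x‖ : ℝ) : ℂ))⁻¹ * ((modeExp a ϖ k x - modeExp a ϖ (k - 1) x) *
          (A - mass a (ϖ * k) * B) - modeExp a ϖ (k - 1) x *
          ((mass a (ϖ * k) - mass a (ϖ * (k - 1 : ℤ))) * B)) := by
      rw [gradMode, gradMode, mode, mode, if_neg hk, if_neg (sub_ne_zero.2 hk1)]
      ring
    rw [e, norm_mul]
    have h1 : ‖(modeExp a ϖ k x - modeExp a ϖ (k - 1) x) * (A - mass a (ϖ * k) * B)‖ ≤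
        K * K' * (Real.exp (-(b * √|(k : ℝ)| * ‖x‖)) / √|(k : ℝ)|) := by
      rw [norm_mul]
      calc _ ≤ K * ‖x‖ * (Real.exp (-(2 * b * √|(k : ℝ)| * ‖x‖)) / √|(k : ℝ)|) *
            (K' / ‖x‖ * Real.exp (b * √|(k : ℝ)| * ‖x‖)) := by
            gcongr
            · exact hEd k x hk hk1
            · exact hfac k x hk hx
        _ = K * K' * ((Real.exp (-(2 * b * √|(k : ℝ)| * ‖x‖)) *
          Real.exp (b * √|(k : ℝ)| * ‖x‖)) / √|(k : ℝ)|) := by field_simp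
        _ = _ := by rw [hexp]
    have h2 : ‖modeExp a ϖ (k - 1) x * ((mass a (ϖ * k) - mass a (ϖ * (k - 1 : ℤ))) * B)‖ ≤
        K * (Real.exp (-(b * √|(k : ℝ)| * ‖x‖)) / √|(k : ℝ)|) := by
      rw [norm_mul, norm_mul]
      calc _ ≤ Real.exp (-(b * √|(k : ℝ)| * ‖x‖)) * (K / √|(k : ℝ)| * 1) := by
            gcongr
            · exact (hE' k x hk hk1).trans (hweak k x)
            · exact hmd k hk
            · rw [hBdef, Complex.norm_real]; exact hB x hx
        _ = _ := by ring
    calc _ ≤ 1 / ‖x‖ * (K * K' * (Real.exp (-(b * √|(k : ℝ)| * ‖x‖)) / √|(k : ℝ)|) +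
          K * (Real.exp (-(b * √|(k : ℝ)| * ‖x‖)) / √|(k : ℝ)|)) := by
          gcongr
          · exact hpre x hx
          · exact (norm_sub_le _ _).trans (add_le_add h1 h2)
      _ = (K * K' + K) / ‖x‖ ^ 1 * (Real.exp (-(b * √|(k : ℝ)| * ‖x‖)) / √|(k : ℝ)|) := by
          rw [pow_one]; ring
      _ ≤ _ := by
        gcongr
        rw [hC]
        linarith

/-! ### Summation over the frequencies. -/

/-- Comparison with the integral of exp(-b√s), whose primitive is -2(1 + b√s)exp(-b√s)/b², carried
out by telescoping. With b proportional to ‖x‖ this is the loss of two powers of ‖x‖. -/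
lemma sum_exp_neg_sqrt_le {b : ℝ} (hb : 0 < b) :
    Summable (fun n : ℕ => Real.exp (-(b * √((n : ℝ) + 1)))) ∧
      ∑' n : ℕ, Real.exp (-(b * √((n : ℝ) + 1))) ≤ 2 / b ^ 2 := by
  have hpart : ∀ n : ℕ, ∑ i ∈ Finset.range n, Real.exp (-(b * √((i : ℝ) + 1))) ≤ 2 / b ^ 2 := by
    have key : ∀ n : ℕ, ∑ i ∈ Finset.range n, Real.exp (-(b * √((i : ℝ) + 1))) ≤
        2 / b ^ 2 - 2 * (1 + b * √(n : ℝ)) * Real.exp (-(b * √(n : ℝ))) / b ^ 2 := by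
      intro n
      induction n with
      | zero => simp
      | succ n ih =>
        rw [Finset.sum_range_succ]
        set u := b * √(n : ℝ) with hu
        set v := b * √((n : ℝ) + 1) with hv
        have hu0 : 0 ≤ u := by positivity
        have huv : u ≤ v := by rw [hu, hv]; gcongr; linarith
        have hsq : v ^ 2 - u ^ 2 = b ^ 2 := by
          rw [hu, hv, mul_pow, mul_pow, Real.sq_sqrt (by positivity), Real.sq_sqrt (by positivity)]
          ring
        -- The quadratic term is needed: it supplies the (v - u)² in v² - u² = 2u(v - u) + (v - u)².
        have hq := Real.quadratic_le_exp_of_nonneg (sub_nonneg.2 huv)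
        have hE : Real.exp (-u) = Real.exp (v - u) * Real.exp (-v) := by
          rw [← Real.exp_add]; congr 1; ring
        have hstep : b ^ 2 * Real.exp (-v) ≤
            2 * (1 + u) * Real.exp (-u) - 2 * (1 + v) * Real.exp (-v) := by
          rw [hE, ← hsq]
          have h1 : (v ^ 2 - u ^ 2) + 2 * (1 + v) ≤ 2 * (1 + u) * Real.exp (v - u) := by
            have h2 : 2 * (1 + u) * (1 + (v - u) + (v - u) ^ 2 / 2) ≤
              2 * (1 + u) * Real.exp (v - u) := by gcongr
            nlinarith [mul_nonneg hu0 (sq_nonneg (v - u))]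
          have := mul_le_mul_of_nonneg_right h1 (Real.exp_pos (-v)).le
          nlinarith
        have hdiv : Real.exp (-v) ≤ 2 * (1 + u) * Real.exp (-u) / b ^ 2 -
            2 * (1 + v) * Real.exp (-v) / b ^ 2 := by
          rw [← sub_div, le_div_iff₀ (by positivity)]; linarith
        push_cast
        linarith
    intro n
    refine (key n).trans ?_
    have : 0 ≤ 2 * (1 + b * √(n : ℝ)) * Real.exp (-(b * √(n : ℝ))) / b ^ 2 := by positivity
    linarith
  exact ⟨summable_of_sum_range_le (fun n => (Real.exp_pos _).le) hpart,
    Real.tsum_le_of_sum_range_le (fun n => (Real.exp_pos _).le) hpart⟩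

/-- The same telescoping with the primitive -2exp(-b√s)/b. The extra 1/√s reduces the loss to a
single power. -/
lemma sum_exp_neg_sqrt_div_sqrt_le {b : ℝ} (hb : 0 < b) :
    Summable (fun n : ℕ => Real.exp (-(b * √((n : ℝ) + 1))) / √((n : ℝ) + 1)) ∧
      ∑' n : ℕ, Real.exp (-(b * √((n : ℝ) + 1))) / √((n : ℝ) + 1) ≤ 2 / b := by
  have hpart : ∀ n : ℕ, ∑ i ∈ Finset.range n,
      Real.exp (-(b * √((i : ℝ) + 1))) / √((i : ℝ) + 1) ≤ 2 / b := by
    have key : ∀ n : ℕ, ∑ i ∈ Finset.range n,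
        Real.exp (-(b * √((i : ℝ) + 1))) / √((i : ℝ) + 1) ≤
        2 / b - 2 * Real.exp (-(b * √(n : ℝ))) / b := by
      intro n
      induction n with
      | zero => simp
      | succ n ih =>
        rw [Finset.sum_range_succ]
        push_cast
        set u := √(n : ℝ) with hu
        set v := √((n : ℝ) + 1) with hv
        have hu0 : 0 ≤ u := by positivity
        have hv0 : 0 < v := Real.sqrt_pos.2 (by positivity)
        have huv : u ≤ v := by rw [hu, hv]; gcongr; linarith
        have hsq : v ^ 2 - u ^ 2 = 1 := by
          rw [hu, hv, Real.sq_sqrt (by positivity), Real.sq_sqrt (by positivity)]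
          ring
        have h1 : 1 / v ≤ 2 * (v - u) := by
          rw [div_le_iff₀ hv0]; nlinarith
        have hE : Real.exp (-(b * u)) = Real.exp (b * (v - u)) * Real.exp (-(b * v)) := by
          rw [← Real.exp_add]; congr 1; ring
        have h2 := Real.add_one_le_exp (b * (v - u))
        have h3 : b * (v - u) * Real.exp (-(b * v)) ≤
            Real.exp (-(b * u)) - Real.exp (-(b * v)) := by
          rw [hE]
          nlinarith [mul_le_mul_of_nonneg_right h2 (Real.exp_pos (-(b * v))).le]
        have h4 : Real.exp (-(b * v)) / v ≤ 2 * (v - u) * Real.exp (-(b * v)) := by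
          rw [div_eq_mul_one_div, mul_comm]
          gcongr
        have h5 : 2 * (v - u) * Real.exp (-(b * v)) ≤
            2 * Real.exp (-(b * u)) / b - 2 * Real.exp (-(b * v)) / b := by
          rw [← sub_div, le_div_iff₀ hb]; linarith
        linarith
    intro n
    refine (key n).trans ?_
    have : 0 ≤ 2 * Real.exp (-(b * √(n : ℝ))) / b := by positivity
    linarith
  exact ⟨summable_of_sum_range_le (fun n => by positivity) hpart,
    Real.tsum_le_of_sum_range_le (fun n => by positivity) hpart⟩

lemma int_summable_of_le {f : ℤ → ℝ} {g : ℕ → ℝ} {d : ℝ} (hf : ∀ k, 0 ≤ f k) (h0 : f 0 ≤ d)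
    (hp : ∀ n : ℕ, f (n + 1) ≤ g n) (hn : ∀ n : ℕ, f (-(n + 1)) ≤ g n) (hg : Summable g) :
    Summable f ∧ ∑' k, f k ≤ d + 2 * ∑' n, g n := by
  have s1 : Summable fun n : ℕ => f (n + 1) := Summable.of_nonneg_of_le (fun n => hf _) hp hg
  have s2 : Summable fun n : ℕ => f (-(n + 1)) := Summable.of_nonneg_of_le (fun n => hf _) hn hg
  have s3 : Summable fun n : ℕ => f n := by
    refine (summable_nat_add_iff 1).1 (s1.congr fun n => ?_)
    push_cast; rfl
  refine ⟨Summable.of_nat_of_neg_add_one s3 s2, ?_⟩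
  rw [tsum_of_nat_of_neg_add_one s3 s2, s3.tsum_eq_zero_add]
  have h1 := s1.tsum_le_tsum hp hg
  have h2 := s2.tsum_le_tsum hn hg
  push_cast
  linarith

lemma abs_intCast_succ (n : ℕ) : |(((n : ℤ) + 1 : ℤ) : ℝ)| = (n : ℝ) + 1 := by
  push_cast; exact abs_of_nonneg (by positivity)

lemma abs_intCast_neg_succ (n : ℕ) : |((-((n : ℤ) + 1) : ℤ) : ℝ)| = (n : ℝ) + 1 := by
  push_cast; rw [abs_neg]; exact abs_of_nonneg (by positivity)

/-- Half of the exponent, using √s ≥ 1, becomes decay in space uniform in the frequency; the other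
half is kept for the summation. -/
lemma exp_neg_mul_sqrt_le {b r s : ℝ} (hb : 0 < b) (hr : 0 < r) (hs : 1 ≤ s) :
    Real.exp (-(b * √s * r)) ≤ Real.exp (-(b / 2 * r)) * Real.exp (-(b * r / 2 * √s)) := by
  rw [← Real.exp_add, Real.exp_le_exp]
  have : 1 ≤ √s := Real.one_le_sqrt.2 hs
  nlinarith [mul_pos hb hr]

namespace IsAdmissible

variable {m : ℕ} {b C : ℝ} {Q : ℤ → E3 → ℂ}

lemma summable_tsum_le (h : IsAdmissible m b C Q) {x : E3} (hx : x ≠ 0) :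
    Summable (fun k => ‖Q k x‖) ∧ ∑' k, ‖Q k x‖ ≤
      (16 * C / b ^ 2) / ‖x‖ ^ (m + 3) * Real.exp (-(b / 2 * ‖x‖)) := by
  have hb := h.b_pos
  have hC := h.C_nonneg
  have hr : 0 < ‖x‖ := norm_pos_iff.2 hx
  have hbr : 0 < b * ‖x‖ / 2 := by positivity
  obtain ⟨hs, hle⟩ := sum_exp_neg_sqrt_le hbr
  have hg := hs.mul_left (C / ‖x‖ ^ (m + 1) * Real.exp (-(b / 2 * ‖x‖)))
  have hk : ∀ k : ℤ, k ≠ 0 → ∀ n : ℕ, |(k : ℝ)| = n + 1 →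
      ‖Q k x‖ ≤ C / ‖x‖ ^ (m + 1) * Real.exp (-(b / 2 * ‖x‖)) *
        Real.exp (-(b * ‖x‖ / 2 * √((n : ℝ) + 1))) := by
    intro k hk n hn
    refine (h.bound k x hk hx).trans ?_
    rw [hn, mul_assoc (C / _)]
    gcongr
    exact exp_neg_mul_sqrt_le hb hr (by linarith [n.cast_nonneg (α := ℝ)])
  have := int_summable_of_le (f := fun k => ‖Q k x‖) (d := 0) (fun k => norm_nonneg _)
    (by simp [h.zero]) (fun n => hk _ (by omega) n (abs_intCast_succ n))
    (fun n => hk _ (by omega) n (abs_intCast_neg_succ n)) hg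
  refine ⟨this.1, this.2.trans ?_⟩
  rw [tsum_mul_left, zero_add]
  calc _ ≤ 2 * (C / ‖x‖ ^ (m + 1) * Real.exp (-(b / 2 * ‖x‖)) * (2 / (b * ‖x‖ / 2) ^ 2)) := by
        gcongr
    _ = _ := by field_simp; ring

/-- A difference is one power of ‖x‖ less singular than a mode and carries 1/√|k|, so its sum loses
one power instead of two. -/
lemma summable_tsum_diff_le (h : IsAdmissible m b C Q) {x : E3} (hx : x ≠ 0) :
    ∑' k, ‖Q k x - Q (k - 1) x‖ ≤
      (3 * C + 8 * C / b) / ‖x‖ ^ (m + 1) * Real.exp (-(b / 2 * ‖x‖)) := by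
  have hb := h.b_pos
  have hC := h.C_nonneg
  have hr : 0 < ‖x‖ := norm_pos_iff.2 hx
  have hbr : 0 < b * ‖x‖ / 2 := by positivity
  obtain ⟨hs, hle⟩ := sum_exp_neg_sqrt_div_sqrt_le hbr
  -- Bounds the two differences at k = 0 and k = 1, which have `Q 0 = 0` as a neighbour and are
  -- single modes of index -1 and 1 up to sign.
  set d : ℝ := C / ‖x‖ ^ (m + 1) * Real.exp (-(b / 2 * ‖x‖)) with hd
  have hd0 : 0 ≤ d := by positivity
  set c : ℝ := C / ‖x‖ ^ m * Real.exp (-(b / 2 * ‖x‖)) with hc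
  have hs1 := hs.mul_left c
  have hsd : HasSum (fun n : ℕ => if n = 0 then d else 0) d := hasSum_ite_eq 0 d
  have hg := hs1.add hsd.summable
  have hone : ∀ k : ℤ, |(k : ℝ)| = 1 → ‖Q k x‖ ≤ d := by
    intro k hk
    have hk0 : k ≠ 0 := by rintro rfl; simp at hk
    refine (h.bound k x hk0 hx).trans ?_
    rw [hk, Real.sqrt_one, mul_one, hd]
    gcongr
    linarith
  have hk : ∀ k : ℤ, k ≠ 0 → ∀ n : ℕ, |(k : ℝ)| = n + 1 →
      ‖Q k x - Q (k - 1) x‖ ≤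
        c * (Real.exp (-(b * ‖x‖ / 2 * √((n : ℝ) + 1))) / √((n : ℝ) + 1)) +
          if n = 0 then d else 0 := by
    intro k hk n hn
    by_cases hk1 : k = 1
    · subst hk1
      have hn0 : n = 0 := by
        have : (1 : ℝ) = n + 1 := by simpa using hn
        have : (n : ℝ) = 0 := by linarith
        exact_mod_cast this
      rw [sub_self, h.zero, sub_zero, if_pos hn0]
      have := hone 1 (by simp)
      have h0 : 0 ≤ c * (Real.exp (-(b * ‖x‖ / 2 * √((n : ℝ) + 1))) / √((n : ℝ) + 1)) := by
        positivity
      linarith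
    · have h0 : (0 : ℝ) ≤ if n = 0 then d else 0 := by split_ifs <;> simp [hd0]
      refine le_trans ?_ (le_add_of_nonneg_right h0)
      refine (h.diff k x hk hk1 hx).trans ?_
      rw [hn, hc, mul_assoc (C / _), ← mul_div_assoc (Real.exp (-(b / 2 * ‖x‖)))]
      gcongr
      exact exp_neg_mul_sqrt_le hb hr (by linarith [n.cast_nonneg (α := ℝ)])
  have := int_summable_of_le (f := fun k => ‖Q k x - Q (k - 1) x‖) (d := d)
    (fun k => norm_nonneg _)
    (by
      simp only [h.zero, zero_sub, norm_neg]
      exact hone _ (by simp))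
    (fun n => hk _ (by omega) n (abs_intCast_succ n))
    (fun n => hk _ (by omega) n (abs_intCast_neg_succ n)) hg
  refine this.2.trans ?_
  rw [hs1.tsum_add hsd.summable, hsd.tsum_eq, tsum_mul_left]
  calc _ ≤ d + 2 * (c * (2 / (b * ‖x‖ / 2)) + d) := by gcongr
    _ = _ := by rw [hc, hd, pow_succ]; field_simp; ring

end IsAdmissible

/-! ### Fourier series in time: interpolation and the weight. -/

section Circle

lemma norm_fourier_apply {T : ℝ} (k : ℤ) (t : AddCircle T) : ‖fourier k t‖ = 1 := by
  rw [fourier_apply]; exact Circle.norm_coe _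

variable {T : ℝ}

/-- The function on `𝕋 × ℝ³` with the given Fourier modes in time. -/
def modeSum (Q : ℤ → E3 → ℂ) (t : AddCircle T) (x : E3) : ℂ := ∑' k : ℤ, fourier k t * Q k x

lemma summable_fourier_mul {a : ℤ → ℂ} (ha : Summable fun k => ‖a k‖) (t : AddCircle T) :
    Summable fun k => fourier k t * a k := by
  refine Summable.of_norm ?_
  simpa only [norm_mul, norm_fourier_apply, one_mul] using ha

lemma norm_tsum_fourier_le {a : ℤ → ℂ} (ha : Summable fun k => ‖a k‖) (t : AddCircle T) :
    ‖∑' k, fourier k t * a k‖ ≤ ∑' k, ‖a k‖ := by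
  have := norm_tsum_le_tsum_norm (f := fun k => fourier k t * a k)
    (by simpa only [norm_mul, norm_fourier_apply, one_mul] using ha)
  simpa only [norm_mul, norm_fourier_apply, one_mul] using this

/-- Summation by parts: multiplication by the first character shifts the coefficients by one. -/
lemma norm_fourier_sub_one_mul_tsum_le {a : ℤ → ℂ} (ha : Summable fun k => ‖a k‖)
    (t : AddCircle T) :
    ‖fourier 1 t - 1‖ * ‖∑' k, fourier k t * a k‖ ≤ ∑' k, ‖a k - a (k - 1)‖ := by
  have ha' : Summable fun k => ‖a (k - 1)‖ :=
    ha.comp_injective (sub_left_injective (b := (1 : ℤ)))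
  have e : (fourier 1 t - 1) * ∑' k, fourier k t * a k =
      ∑' k, fourier k t * (a (k - 1) - a k) := by
    have h1 := summable_fourier_mul ha t
    have h2 := summable_fourier_mul ha' t
    have h3 : fourier 1 t * ∑' k, fourier k t * a k = ∑' k, fourier k t * a (k - 1) := by
      rw [← tsum_mul_left, ← (Equiv.subRight (1 : ℤ)).tsum_eq]
      refine tsum_congr fun k => ?_
      rw [Equiv.subRight_apply, ← mul_assoc, ← fourier_add]
      congr 2
      ring_nf
    rw [sub_mul, one_mul, h3, ← h2.tsum_sub h1]
    simp_rw [mul_sub]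
  rw [← norm_mul, e]
  have hd : Summable fun k => ‖a (k - 1) - a k‖ :=
    Summable.of_nonneg_of_le (fun _ => norm_nonneg _) (fun k => norm_sub_le _ _) (ha'.add ha)
  refine (norm_tsum_fourier_le hd t).trans (le_of_eq ?_)
  simp_rw [norm_sub_rev]

/-- Interpolation between the sum of the modes and the sum of their differences. -/
lemma norm_tsum_fourier_interpolate {a : ℤ → ℂ} (ha : Summable fun k => ‖a k‖)
    {t : AddCircle T} (ht : 0 < ‖fourier 1 t - 1‖) {γ A₀ A₁ : ℝ} (hγ0 : 0 < γ) (hγ1 : γ < 1)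
    (h0 : ∑' k, ‖a k‖ ≤ A₀) (h1 : ∑' k, ‖a k - a (k - 1)‖ ≤ A₁) :
    ‖∑' k, fourier k t * a k‖ ≤
      A₀ ^ γ * A₁ ^ (1 - γ) * ‖fourier 1 t - 1‖ ^ (-(1 - γ)) := by
  set f := ‖∑' k, fourier k t * a k‖ with hf
  have hf0 : 0 ≤ f := norm_nonneg _
  have hA0 : f ≤ A₀ := (norm_tsum_fourier_le ha t).trans h0
  have hA1 : f ≤ A₁ / ‖fourier 1 t - 1‖ := by
    rw [le_div_iff₀ ht, mul_comm]
    exact (norm_fourier_sub_one_mul_tsum_le ha t).trans h1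
  have hA1' : 0 ≤ A₁ := le_trans (tsum_nonneg fun k => norm_nonneg _) h1
  calc f = f ^ γ * f ^ (1 - γ) := by
        rw [← Real.rpow_add_of_nonneg hf0 hγ0.le (by linarith)]; simp
    _ ≤ A₀ ^ γ * (A₁ / ‖fourier 1 t - 1‖) ^ (1 - γ) := by
        have hA0' : 0 ≤ A₀ := hf0.trans hA0
        have : 0 ≤ 1 - γ := by linarith
        gcongr
    _ = _ := by
        rw [Real.div_rpow hA1' ht.le, Real.rpow_neg ht.le, div_eq_mul_inv, mul_assoc]

/-- The exponents combine to γ(m + 3) + (1 - γ)(m + 1) = m + 1 + 2γ. Both bounds are given the same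
constant and exponential rate, so neither depends on γ after interpolation. -/
lemma IsAdmissible.norm_modeSum_le {m : ℕ} {b C : ℝ} {Q : ℤ → E3 → ℂ} (h : IsAdmissible m b C Q)
    {γ : ℝ} (hγ0 : 0 < γ) (hγ1 : γ < 1) {x : E3} (hx : x ≠ 0) {t : AddCircle T}
    (ht : 0 < ‖fourier 1 t - 1‖) :
    ‖modeSum Q t x‖ ≤ (16 * C / b ^ 2 + (3 * C + 8 * C / b)) * ‖x‖ ^ (-(m + 1 + 2 * γ)) *
      Real.exp (-(b / 2 * ‖x‖)) * ‖fourier 1 t - 1‖ ^ (-(1 - γ)) := by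
  have hb := h.b_pos
  have hC := h.C_nonneg
  have hr : 0 < ‖x‖ := norm_pos_iff.2 hx
  obtain ⟨hs, hle⟩ := h.summable_tsum_le hx
  set K : ℝ := 16 * C / b ^ 2 + (3 * C + 8 * C / b) with hK
  have hK0 : 0 ≤ K := by positivity
  have hle' : ∑' k, ‖Q k x‖ ≤ K / ‖x‖ ^ (m + 3) * Real.exp (-(b / 2 * ‖x‖)) := by
    refine hle.trans ?_
    gcongr
    rw [hK]
    have : 0 ≤ 3 * C + 8 * C / b := by positivity
    linarith
  have hle1 : ∑' k, ‖Q k x - Q (k - 1) x‖ ≤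
      K / ‖x‖ ^ (m + 1) * Real.exp (-(b / 2 * ‖x‖)) := by
    refine (h.summable_tsum_diff_le hx).trans ?_
    gcongr
    rw [hK]
    have : 0 ≤ 16 * C / b ^ 2 := by positivity
    linarith
  refine (norm_tsum_fourier_interpolate hs ht hγ0 hγ1 hle' hle1).trans (le_of_eq ?_)
  congr 1
  set r := ‖x‖ with hrdef
  set E := Real.exp (-(b / 2 * r)) with hE
  have hE0 : 0 < E := Real.exp_pos _
  have e1 : K / r ^ (m + 3) * E = (K * E) * r ^ (-((m : ℝ) + 3)) := by
    rw [Real.rpow_neg hr.le]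
    have : r ^ ((m : ℝ) + 3) = r ^ (m + 3) := by rw [← Real.rpow_natCast]; push_cast; rfl
    rw [this]; ring
  have e2 : K / r ^ (m + 1) * E = (K * E) * r ^ (-((m : ℝ) + 1)) := by
    rw [Real.rpow_neg hr.le]
    have : r ^ ((m : ℝ) + 1) = r ^ (m + 1) := by rw [← Real.rpow_natCast]; push_cast; rfl
    rw [this]; ring
  have hKE : 0 ≤ K * E := by positivity
  rw [e1, e2, Real.mul_rpow hKE (by positivity), Real.mul_rpow hKE (by positivity), ← Real.rpow_mul hr.le, ← Real.rpow_mul hr.le]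
  have e3 : (K * E) ^ γ * (K * E) ^ (1 - γ) = K * E := by
    rw [← Real.rpow_add_of_nonneg (by positivity) hγ0.le (by linarith)]; simp
  have e4 : r ^ (-((m : ℝ) + 3) * γ) * r ^ (-((m : ℝ) + 1) * (1 - γ)) =
      r ^ (-(m + 1 + 2 * γ)) := by
    rw [← Real.rpow_add hr]; congr 1; ring
  rw [mul_mul_mul_comm, e3, e4]; ring

variable [Fact (0 < T)]

/-- The chord length is 2|sin(πt/T)|, bounded below by Jordan's inequality. -/
lemma norm_fourier_one_sub_one_ge {t : ℝ} (ht : |t| ≤ T / 2) :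
    4 / T * |t| ≤ ‖fourier 1 (t : AddCircle T) - 1‖ := by
  have hT : 0 < T := Fact.out
  have h1 : fourier 1 (t : AddCircle T) = cexp (I * ((2 * Real.pi * t / T : ℝ) : ℂ)) := by
    rw [fourier_coe_apply]; congr 1; push_cast; ring
  rw [h1, Complex.norm_exp_I_mul_ofReal_sub_one, Real.norm_eq_abs, abs_mul, abs_two]
  have hpi := Real.pi_pos
  have h2 : |2 * Real.pi * t / T / 2| = Real.pi / T * |t| := by
    rw [show 2 * Real.pi * t / T / 2 = Real.pi / T * t by ring, abs_mul,
      abs_of_pos (by positivity)]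
  have h3 := Real.mul_abs_le_abs_sin (x := 2 * Real.pi * t / T / 2) (by
    rw [h2]
    calc Real.pi / T * |t| ≤ Real.pi / T * (T / 2) := by gcongr
      _ = Real.pi / 2 := by field_simp)
  rw [h2] at h3
  calc 4 / T * |t| = 2 * (2 / Real.pi * (Real.pi / T * |t|)) := by field_simp; ring
    _ ≤ _ := by gcongr

lemma ae_fourier_one_ne_one :
    ∀ᵐ t : AddCircle T ∂AddCircle.haarAddCircle, 0 < ‖fourier 1 t - 1‖ := by
  have hT : 0 < T := Fact.out
  have h0 : (AddCircle.haarAddCircle (T := T)) {0} = 0 := by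
    have h1 : (volume : Measure (AddCircle T)) {0} = 0 := by
      rw [← Metric.closedBall_zero, AddCircle.volume_closedBall]; simp
    rw [AddCircle.volume_eq_smul_haarAddCircle, Measure.smul_apply, smul_eq_mul,
      mul_eq_zero] at h1
    exact h1.resolve_left (by simpa using hT)
  have h2 : ∀ᵐ t : AddCircle T ∂AddCircle.haarAddCircle, t ≠ 0 := by
    rw [ae_iff]; simpa using h0
  filter_upwards [h2] with t ht
  rw [norm_pos_iff, sub_ne_zero, fourier_one]
  intro h
  apply ht
  apply AddCircle.injective_toCircle hT.ne'
  rw [AddCircle.toCircle_zero]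
  exact Circle.ext h

/-- Near t = 0 the q-th power of the weight is at most a multiple of |t|^(-p) with p = (1 - γ)q < 1.
-/
lemma eLpNorm_fourier_weight_lt_top {γ q : ℝ} (hγ1 : γ < 1) (hq : 1 ≤ q)
    (hq' : q < 1 / (1 - γ)) :
    eLpNorm (fun t : AddCircle T => ‖fourier 1 t - 1‖ ^ (-(1 - γ))) (ENNReal.ofReal q)
      AddCircle.haarAddCircle < ⊤ := by
  have hT : 0 < T := Fact.out
  have hq0 : 0 < q := by linarith
  have hγ : 0 < 1 - γ := by linarith
  set p := (1 - γ) * q with hp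
  have hp0 : 0 < p := by positivity
  have hp1 : p < 1 := by
    rw [lt_div_iff₀ hγ] at hq'; rw [hp]; linarith
  rw [eLpNorm_lt_top_iff_lintegral_rpow_enorm_lt_top (by simpa using hq0) ENNReal.ofReal_ne_top,
    ENNReal.toReal_ofReal hq0.le]
  -- On the period interval centred at 0 the factor exp T outweighs exp(-|t|), so the integrable
  -- majorant on ℝ can be reused.
  have hint := (integrable_norm_rpow_mul_exp_finrank (V := ℝ) (s := p) (c := 1)
    (by simpa using hp1) one_pos).const_mul ((4 / T) ^ (-p) * Real.exp T)
  have hvol : ∫⁻ t : AddCircle T, ‖‖fourier 1 t - 1‖ ^ (-(1 - γ))‖ₑ ^ q < ⊤ := by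
    rw [← AddCircle.lintegral_preimage T (-(T / 2))]
    refine lt_of_le_of_lt ?_ hint.lintegral_lt_top
    refine (lintegral_mono_ae ?_).trans (setLIntegral_le_lintegral (Ioc (-(T / 2)) _) _)
    have hne : ∀ᵐ t : ℝ ∂volume.restrict (Ioc (-(T / 2)) (-(T / 2) + T)), t ≠ 0 :=
      ae_restrict_of_ae (by simp [ae_iff])
    filter_upwards [ae_restrict_mem measurableSet_Ioc, hne] with t ht ht0
    have ht' : |t| ≤ T / 2 := abs_le.2 ⟨by linarith [ht.1], by linarith [ht.2]⟩
    have hge := norm_fourier_one_sub_one_ge ht'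
    have hpos : 0 < |t| := abs_pos.2 ht0
    rw [← ofReal_norm, Real.norm_of_nonneg (by positivity),
      ENNReal.ofReal_rpow_of_nonneg (by positivity) hq0.le]
    apply ENNReal.ofReal_le_ofReal
    rw [← Real.rpow_mul (norm_nonneg _), neg_mul, ← hp]
    have h1 : ‖fourier 1 (t : AddCircle T) - 1‖ ^ (-p) ≤ (4 / T * |t|) ^ (-p) :=
      Real.rpow_le_rpow_of_nonpos (by positivity) hge (by linarith)
    refine h1.trans ?_
    rw [Real.mul_rpow (by positivity) (by positivity), Real.norm_eq_abs]
    have h2 : 1 ≤ Real.exp T * Real.exp (-(1 * |t|)) := by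
      rw [← Real.exp_add]; exact Real.one_le_exp (by linarith)
    have h3 : 0 ≤ (4 / T) ^ (-p) * |t| ^ (-p) := by positivity
    nlinarith [mul_le_mul_of_nonneg_left h2 h3]
  rw [AddCircle.volume_eq_smul_haarAddCircle, lintegral_smul_measure, smul_eq_mul] at hvol
  exact (ENNReal.mul_lt_top_iff.1 hvol).elim (fun h => h.2) (fun h => h.elim
    (fun h => absurd h (by simpa using hT)) (fun h => by rw [h]; exact ENNReal.zero_lt_top))

end Circle

/-! ### Regularity of the series away from the origin. -/

lemma coordinate_apply (j : Fin 3) (v : E3) : (EuclideanSpace.proj j : E3 →L[ℝ] ℝ) v = v j := rfl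

/-- Serves twice: ε = 0 gives the norm away from the origin, ε > 0 the smooth radius used for
integration by parts across it. -/
lemma hasFDerivAt_radius (ε : ℝ) {x : E3} (hx : 0 < ‖x‖ ^ 2 + ε ^ 2) :
    HasFDerivAt (fun y : E3 => √(‖y‖ ^ 2 + ε ^ 2))
      (∑ j, (x j / √(‖x‖ ^ 2 + ε ^ 2)) • (EuclideanSpace.proj j : E3 →L[ℝ] ℝ)) x := by
  have h1 : HasFDerivAt (fun y : E3 => ‖y‖ ^ 2 + ε ^ 2) (2 • innerSL ℝ x) x :=
    (hasStrictFDerivAt_norm_sq x).hasFDerivAt.add_const _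
  have h2 := h1.sqrt hx.ne'
  refine h2.congr_fderiv ?_
  ext v
  have hs : √(‖x‖ ^ 2 + ε ^ 2) ≠ 0 := (Real.sqrt_pos.2 hx).ne'
  simp only [smul_apply, innerSL_apply_apply, PiLp.inner_apply,
    RCLike.inner_apply, conj_trivial, smul_eq_mul, nsmul_eq_mul, add_apply,
    coordinate_apply, Fin.sum_univ_three]
  push_cast
  field_simp

/-- The linear form with the given partial derivatives. -/
def gradForm (g : Fin 3 → ℂ) : E3 →L[ℝ] ℂ :=
  ∑ j, (EuclideanSpace.proj j : E3 →L[ℝ] ℝ).smulRight (g j)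

lemma gradForm_apply (g : Fin 3 → ℂ) (v : E3) : gradForm g v = ∑ j, (v j : ℂ) * g j := by
  simp [gradForm]

lemma gradForm_single (g : Fin 3 → ℂ) (j : Fin 3) :
    gradForm g (EuclideanSpace.single j 1) = g j := by
  rw [gradForm_apply, Finset.sum_eq_single j] <;> simp +contextual

lemma norm_gradForm_le (g : Fin 3 → ℂ) : ‖gradForm g‖ ≤ ∑ j, ‖g j‖ := by
  refine (norm_sum_le _ _).trans (Finset.sum_le_sum fun j _ => ?_)
  rw [ContinuousLinearMap.norm_smulRight_apply]
  refine mul_le_of_le_one_left (norm_nonneg _) ?_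
  refine ContinuousLinearMap.opNorm_le_bound _ zero_le_one fun x => ?_
  rw [one_mul]
  exact PiLp.norm_apply_le x j

/-- The derivative of a screened potential whose radius `ρ` satisfies `∇ρ = x / ρ`. -/
lemma hasFDerivAt_screened {ρ : E3 → ℝ} {x : E3} (hρ : ρ x ≠ 0)
    (h : HasFDerivAt ρ (∑ j, (x j / ρ x) • (EuclideanSpace.proj j : E3 →L[ℝ] ℝ)) x)
    (μ : ℂ) (a : ℝ) :
    HasFDerivAt (fun y : E3 => (((4 * Real.pi * ρ y : ℝ) : ℂ))⁻¹ * cexp (-μ * ρ y - a * y 0))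
      (gradForm fun j => (((4 * Real.pi * ρ x : ℝ) : ℂ))⁻¹ * cexp (-μ * ρ x - a * x 0) *
        ((-(if j = 0 then a else 0) - x j / ρ x ^ 2 : ℝ) - μ * (x j / ρ x : ℝ))) x := by
  have hc : HasFDerivAt (fun y : E3 => ((ρ y : ℝ) : ℂ))
      (ofRealCLM.comp (∑ j, (x j / ρ x) • (EuclideanSpace.proj j : E3 →L[ℝ] ℝ))) x :=
    ofRealCLM.hasFDerivAt.comp x h
  have h0 : HasFDerivAt (fun y : E3 => ((y 0 : ℝ) : ℂ))
      (ofRealCLM.comp (EuclideanSpace.proj 0 : E3 →L[ℝ] ℝ)) x :=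
    (ofRealCLM.comp (EuclideanSpace.proj 0 : E3 →L[ℝ] ℝ)).hasFDerivAt
  have h1 := ((hc.const_mul (-μ)).sub (h0.const_mul (a : ℂ))).cexp
  have hpi : (Real.pi : ℂ) ≠ 0 := ofReal_ne_zero.2 Real.pi_ne_zero
  have hρ' : ((ρ x : ℝ) : ℂ) ≠ 0 := ofReal_ne_zero.2 hρ
  have h2 : HasFDerivAt (fun y : E3 => (((4 * Real.pi * ρ y : ℝ) : ℂ))⁻¹)
      (-((4 * Real.pi : ℂ)⁻¹ * ((ρ x : ℂ) ^ 2)⁻¹) •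
        (ofRealCLM.comp (∑ j, (x j / ρ x) • (EuclideanSpace.proj j : E3 →L[ℝ] ℝ)))) x := by
    have h3 := (hasDerivAt_inv hρ').comp_hasFDerivAt x hc
    have h4 := h3.const_mul ((4 * Real.pi : ℂ)⁻¹)
    refine (h4.congr_fderiv ?_).congr_of_eventuallyEq (Eventually.of_forall fun y => ?_)
    · rw [smul_smul]; congr 1; ring
    · simp only [Function.comp_apply]; push_cast; rw [mul_inv]
  refine (h2.mul h1).congr_fderiv ?_
  ext v
  simp only [gradForm_apply, add_apply, smul_apply,
    sub_apply, ContinuousLinearMap.comp_apply,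
    coordinate_apply, Pi.sub_apply, ofRealCLM_apply, smul_eq_mul, Fin.sum_univ_three]
  simp only [Fin.isValue, ↓reduceIte, one_ne_zero, Fin.reduceEq]
  push_cast
  field_simp
  ring

lemma hasFDerivAt_mode (a ϖ : ℝ) {k : ℤ} {x : E3} (hx : x ≠ 0) :
    HasFDerivAt (mode a ϖ k) (gradForm fun j => gradMode a ϖ j k x) x := by
  by_cases hk : k = 0
  · subst hk
    have e : mode a ϖ 0 = fun _ => 0 := by ext; simp [mode]
    have e' : (gradForm fun j => gradMode a ϖ j 0 x) = 0 := by
      ext v; simp [gradForm_apply, gradMode, mode]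
    rw [e, e']
    exact hasFDerivAt_const _ _
  have hr : 0 < ‖x‖ := norm_pos_iff.2 hx
  have h := hasFDerivAt_radius 0 (x := x) (by positivity)
  have e : ∀ y : E3, √(‖y‖ ^ 2 + 0 ^ 2) = ‖y‖ := fun y => by
    rw [zero_pow two_ne_zero, add_zero, Real.sqrt_sq (norm_nonneg y)]
  simp only [e] at h
  have h2 := hasFDerivAt_screened (ρ := fun y => ‖y‖) hr.ne' h (mass a (ϖ * k)) a
  have e1 : mode a ϖ k = fun y : E3 => (((4 * Real.pi * ‖y‖ : ℝ) : ℂ))⁻¹ *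
      cexp (-mass a (ϖ * k) * ‖y‖ - a * y 0) := by
    ext y; rw [mode, if_neg hk, modeExp]
  rw [e1]
  refine h2.congr_fderiv ?_
  congr 1
  ext j
  rw [gradMode, e1]

namespace IsAdmissible

variable {m : ℕ} {b C : ℝ} {Q : ℤ → E3 → ℂ}

/-- Majorants for the Weierstrass test, uniform outside a ball around the origin. -/
lemma exists_summable_bound (h : IsAdmissible m b C Q) {δ : ℝ} (hδ : 0 < δ) :
    ∃ u : ℤ → ℝ, Summable u ∧ ∀ k (x : E3), δ ≤ ‖x‖ → ‖Q k x‖ ≤ u k := by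
  have hb := h.b_pos
  have hC := h.C_nonneg
  set u : ℤ → ℝ := fun k => if k = 0 then 0 else
    C / δ ^ (m + 1) * Real.exp (-(b * δ * √|(k : ℝ)|)) with hu
  refine ⟨u, ?_, ?_⟩
  · have hs := (sum_exp_neg_sqrt_le (show 0 < b * δ by positivity)).1.mul_left (C / δ ^ (m + 1))
    refine (int_summable_of_le (f := u) (d := 0) (fun k => ?_) ?_ (fun n => ?_) (fun n => ?_) hs).1
    · simp only [hu]; split_ifs <;> positivity
    · simp [hu]
    · simp only [hu]; rw [if_neg (by omega), abs_intCast_succ]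
    · simp only [hu]; rw [if_neg (by omega), abs_intCast_neg_succ]
  · intro k x hx
    by_cases hk : k = 0
    · subst hk; simp [hu, h.zero]
    · have hr : 0 < ‖x‖ := hδ.trans_le hx
      simp only [hu]
      rw [if_neg hk]
      refine (h.bound k x hk (norm_pos_iff.1 hr)).trans ?_
      rw [mul_right_comm b δ]
      gcongr

lemma continuousOn_modeSum (h : IsAdmissible m b C Q) (T : ℝ) :
    ContinuousOn (fun z : AddCircle T × E3 => modeSum Q z.1 z.2) {z | z.2 ≠ 0} := by
  intro z₀ hz₀
  have hz₀ : z₀.2 ≠ 0 := hz₀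
  have hr : 0 < ‖z₀.2‖ := norm_pos_iff.2 hz₀
  set δ := ‖z₀.2‖ / 2 with hδ
  have hδ0 : 0 < δ := by positivity
  set s : Set (AddCircle T × E3) := {z | δ < ‖z.2‖} with hs
  have hso : IsOpen s := isOpen_lt continuous_const (by fun_prop)
  have hmem : z₀ ∈ s := by change δ < ‖z₀.2‖; linarith
  obtain ⟨u, hu, hle⟩ := h.exists_summable_bound hδ0
  have hcont : ContinuousOn (fun z : AddCircle T × E3 => modeSum Q z.1 z.2) s := by
    refine continuousOn_tsum (fun k => ?_) hu (fun k z hz => ?_)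
    · refine ContinuousOn.mul (by fun_prop) ?_
      refine (h.cont k).comp continuousOn_snd fun z hz => ?_
      have hz : δ < ‖z.2‖ := hz
      exact norm_pos_iff.1 (hδ0.trans hz)
    · rw [norm_mul, norm_fourier_apply, one_mul]
      exact hle k z.2 (le_of_lt hz)
  exact (hcont.continuousAt (hso.mem_nhds hmem)).continuousWithinAt

end IsAdmissible

/-- Termwise differentiation on the ball of radius ‖x‖/2 about x, which keeps distance ‖x‖/2 from
the singularity. -/
lemma hasFDerivAt_modeSum {a ϖ b C : ℝ} {T : ℝ} (h0 : IsAdmissible 0 b C (mode a ϖ))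
    (h1 : ∀ j, IsAdmissible 1 b C (gradMode a ϖ j)) (t : AddCircle T) {x : E3} (hx : x ≠ 0) :
    HasFDerivAt (modeSum (mode a ϖ) t) (gradForm fun j => modeSum (gradMode a ϖ j) t x) x := by
  have hr : 0 < ‖x‖ := norm_pos_iff.2 hx
  set δ := ‖x‖ / 2 with hδ
  have hδ0 : 0 < δ := by positivity
  choose u hu hle using fun j => (h1 j).exists_summable_bound hδ0
  have hball : ∀ y ∈ Metric.ball x δ, δ ≤ ‖y‖ := by
    intro y hy
    rw [mem_ball_iff_norm'] at hy
    have := norm_le_norm_add_norm_sub' x y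
    linarith
  have hsum : Summable fun k : ℤ => ∑ j, u j k := summable_sum fun j _ => hu j
  have key := hasFDerivAt_tsum_of_isPreconnected (𝕜 := ℝ)
    (f := fun (k : ℤ) y => fourier k t * mode a ϖ k y)
    (f' := fun (k : ℤ) y => fourier k t • gradForm fun j => gradMode a ϖ j k y)
    (s := Metric.ball x δ) (x₀ := x) (x := x) hsum Metric.isOpen_ball
    (convex_ball x δ).isPreconnected
    (fun k y hy => (hasFDerivAt_mode a ϖ
      (norm_pos_iff.1 (hδ0.trans_le (hball y hy)))).const_mul _)
    (fun k y hy => by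
      rw [norm_smul, norm_fourier_apply, one_mul]
      refine (norm_gradForm_le _).trans (Finset.sum_le_sum fun j _ => ?_)
      exact hle j k y (hball y hy))
    (Metric.mem_ball_self hδ0) (summable_fourier_mul (h0.summable_tsum_le hx).1 t)
    (Metric.mem_ball_self hδ0)
  refine key.congr_fderiv ?_
  have hs : Summable fun k : ℤ => (fourier k t : ℂ) • gradForm fun j => gradMode a ϖ j k x := by
    refine Summable.of_norm_bounded hsum fun k => ?_
    rw [norm_smul, norm_fourier_apply, one_mul]
    refine (norm_gradForm_le _).trans (Finset.sum_le_sum fun j _ => ?_)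
    exact hle j k x (hball x (Metric.mem_ball_self hδ0))
  ext v
  have h2 := (ContinuousLinearMap.apply ℝ ℂ v).map_tsum hs
  simp only [ContinuousLinearMap.apply_apply] at h2
  rw [h2, gradForm_apply]
  simp only [smul_apply, gradForm_apply, smul_eq_mul, Finset.mul_sum]
  rw [Summable.tsum_finsetSum]
  · refine Finset.sum_congr rfl fun j _ => ?_
    rw [modeSum, ← tsum_mul_left]
    exact tsum_congr fun k => by ring
  · intro j _
    have := (summable_fourier_mul ((h1 j).summable_tsum_le hx).1 t).mul_left (v j : ℂ)
    exact this.congr fun k => by ring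

lemma pdx_modeSum {a ϖ b C : ℝ} {T : ℝ} (h0 : IsAdmissible 0 b C (mode a ϖ))
    (h1 : ∀ j, IsAdmissible 1 b C (gradMode a ϖ j)) (j : Fin 3) (t : AddCircle T) {x : E3}
    (hx : x ≠ 0) :
    pdx j (modeSum (mode a ϖ)) t x = modeSum (gradMode a ϖ j) t x := by
  rw [pdx, (hasFDerivAt_modeSum h0 h1 t hx).fderiv, gradForm_single]

/-! ### Test functions and the pairing with a single mode. -/

open scoped SchwartzMap FourierTransform

namespace IsSchwartzBruhat

variable {T : ℝ} {ψ : AddCircle T → E3 → ℂ}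

lemma continuous (h : IsSchwartzBruhat T ψ) :
    Continuous fun z : AddCircle T × E3 => ψ z.1 z.2 := by
  have hq : IsOpenQuotientMap (Prod.map (QuotientAddGroup.mk : ℝ → AddCircle T) (id : E3 → E3)) :=
    QuotientAddGroup.isOpenQuotientMap_mk.prodMap IsOpenQuotientMap.id
  rw [← hq.continuous_comp_iff]
  exact h.1.continuous

/-- The time slices are Schwartz functions whose seminorms are bounded uniformly in time. -/
lemma exists_schwartz (h : IsSchwartzBruhat T ψ) :
    ∃ B : ℕ → ℕ → ℝ, (∀ k n, 0 ≤ B k n) ∧ ∀ t : AddCircle T, ∃ g : 𝓢(E3, ℂ),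
      (∀ x, g x = ψ t x) ∧ ∀ k n, SchwartzMap.seminorm ℂ k n g ≤ B k n := by
  choose B hB using h.2
  have hB0 : ∀ k n, 0 ≤ B k n := fun k n => le_trans (by positivity) (hB k n 0)
  refine ⟨B, hB0, fun t => ?_⟩
  obtain ⟨s, rfl⟩ := QuotientAddGroup.mk_surjective t
  set inr : E3 →L[ℝ] ℝ × E3 := ContinuousLinearMap.inr ℝ ℝ E3 with hinr
  have hn1 : ‖inr‖ ≤ 1 := ContinuousLinearMap.norm_inr_le_one ℝ ℝ E3
  set f : ℝ × E3 → ℂ := fun z => lift T ψ (z + (s, 0)) with hf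
  have hfc : ContDiff ℝ ∞ f := h.1.comp (contDiff_id.add contDiff_const)
  have hfun : (fun x => ψ (s : AddCircle T) x) = f ∘ inr := by
    ext x; simp [hf, hinr, lift]
  have hder : ∀ k n (x : E3),
      ‖x‖ ^ k * ‖iteratedFDeriv ℝ n (fun x => ψ (s : AddCircle T) x) x‖ ≤ B k n := by
    intro k n x
    rw [hfun, inr.iteratedFDeriv_comp_right hfc x (by exact_mod_cast le_top)]
    have h1 := (iteratedFDeriv ℝ n f (inr x)).norm_compContinuousLinearMap_le fun _ => inr
    have h2 : ∏ _i : Fin n, ‖inr‖ ≤ 1 := Finset.prod_le_one (fun _ _ => norm_nonneg _)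
      fun _ _ => hn1
    have h3 : iteratedFDeriv ℝ n f (inr x) = iteratedFDeriv ℝ n (lift T ψ) (inr x + (s, 0)) :=
      iteratedFDeriv_comp_add_right n (s, 0) (inr x)
    have h4 := hB k n (inr x + (s, 0))
    have h5 : (inr x + (s, (0 : E3))).2 = x := by simp [hinr]
    rw [h5] at h4
    refine le_trans ?_ h4
    gcongr
    rw [← h3]
    exact h1.trans (mul_le_of_le_one_right (norm_nonneg _) h2)
  have hcd : ContDiff ℝ ∞ fun x => ψ (s : AddCircle T) x := by
    rw [hfun]; exact hfc.comp inr.contDiff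
  exact ⟨⟨fun x => ψ (s : AddCircle T) x, hcd, fun k n => ⟨B k n, hder k n⟩⟩, fun x => rfl,
    fun k n => SchwartzMap.seminorm_le_bound ℂ k n _ (hB0 k n) (hder k n)⟩

lemma exists_norm_le (h : IsSchwartzBruhat T ψ) : ∃ B, 0 ≤ B ∧ ∀ t x, ‖ψ t x‖ ≤ B := by
  obtain ⟨B, hB⟩ := h.2 0 0
  have hb : ∀ t x, ‖ψ t x‖ ≤ B := by
    intro t x
    obtain ⟨s, rfl⟩ := QuotientAddGroup.mk_surjective t
    simpa [lift] using hB (s, x)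
  exact ⟨B, (norm_nonneg _).trans (hb 0 0), hb⟩

end IsSchwartzBruhat

lemma schwartz_norm_le_of_seminorm (g : 𝓢(E3, ℂ)) (x : E3) :
    ‖g x‖ ≤ 2 ^ 4 * (Finset.Iic (4, 0)).sup (schwartzSeminormFamily ℂ E3 ℂ) g *
      (1 + ‖x‖) ^ (-(4 : ℝ)) := by
  have h := SchwartzMap.one_add_le_sup_seminorm_apply (𝕜 := ℂ) (m := (4, 0)) (k := 4) (n := 0)
    le_rfl le_rfl g x
  rw [norm_iteratedFDeriv_zero] at h
  have hp : 0 < 1 + ‖x‖ := by positivity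
  rw [Real.rpow_neg hp.le, ← div_eq_mul_inv, le_div_iff₀ (by positivity), mul_comm]
  exact_mod_cast h

/-- The inverse Fourier transform is continuous on Schwartz space, so uniform seminorm bounds pass
to the transforms. The exponent 4 > 3 makes the bound integrable over ℝ³. -/
lemma exists_fourierInv_bound {ι : Type*} {g : ι → 𝓢(E3, ℂ)} {B : ℕ → ℕ → ℝ}
    (hB0 : ∀ k n, 0 ≤ B k n) (hB : ∀ i k n, SchwartzMap.seminorm ℂ k n (g i) ≤ B k n) :
    ∃ D, ∀ i x, ‖𝓕⁻ (g i : E3 → ℂ) x‖ ≤ D * (1 + ‖x‖) ^ (-(4 : ℝ)) := by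
  set q : Seminorm ℂ 𝓢(E3, ℂ) := (Finset.Iic (4, 0)).sup (schwartzSeminormFamily ℂ E3 ℂ) with hq
  set A : 𝓢(E3, ℂ) →L[ℂ] 𝓢(E3, ℂ) := FourierTransform.fourierInvCLM ℂ 𝓢(E3, ℂ) with hA
  have hqc : Continuous q :=
    Seminorm.continuous_finsetSup fun i _ => (schwartz_withSeminorms ℂ E3 ℂ).continuous_seminorm i
  have hcomp : Continuous (q.comp A.toLinearMap) := hqc.comp A.continuous
  obtain ⟨s, C, -, hle⟩ := Seminorm.bound_of_continuous (schwartz_withSeminorms ℂ E3 ℂ) _ hcomp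
  have hsum0 : 0 ≤ ∑ p ∈ s, B p.1 p.2 := Finset.sum_nonneg fun p _ => hB0 _ _
  have hsup : ∀ i, s.sup (schwartzSeminormFamily ℂ E3 ℂ) (g i) ≤ ∑ p ∈ s, B p.1 p.2 := by
    intro i
    refine Seminorm.finset_sup_apply_le hsum0 fun p hp => (hB i p.1 p.2).trans ?_
    exact Finset.single_le_sum (f := fun p : ℕ × ℕ => B p.1 p.2) (fun p _ => hB0 _ _) hp
  refine ⟨2 ^ 4 * (C * ∑ p ∈ s, B p.1 p.2), fun i x => ?_⟩
  rw [← SchwartzMap.fourierInv_coe]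
  refine (schwartz_norm_le_of_seminorm _ x).trans ?_
  gcongr
  have := hle (g i)
  refine this.trans ?_
  change (C : ℝ) * _ ≤ _
  gcongr
  exact hsup i

/-- Pairing of the Fourier transform of an integrable function with a Schwartz function. -/
lemma integral_fourier_mul_schwartz {P : E3 → ℂ} (hP : Integrable P) {m : E3 → ℂ}
    (hm : ∀ ξ, m ξ = ∫ x, P x * cexp (-(I * (inner ℝ x ξ : ℝ)))) (g : 𝓢(E3, ℂ)) :
    ∫ ξ, m ξ * ∫ x, g x * cexp (I * (inner ℝ x ξ : ℝ)) =
      ((2 * Real.pi : ℝ) ^ 3 : ℂ) * ∫ x, P x * g x := by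
  have hpi := Real.pi_pos
  -- The substitution ξ = 2πw passes to the convention with exp(2πi x·w); its Jacobian is the factor
  -- (2π)³.
  have h1 := Measure.integral_comp_smul (volume : Measure E3)
    (fun ξ => m ξ * ∫ x, g x * cexp (I * (inner ℝ x ξ : ℝ))) (2 * Real.pi)
  have h2 : ∀ w : E3, m ((2 * Real.pi) • w) = 𝓕 P w := by
    intro w
    rw [hm, Real.fourier_eq']
    refine integral_congr_ae (Eventually.of_forall fun x => ?_)
    simp only [inner_smul_right, smul_eq_mul]
    rw [mul_comm]
    congr 2
    push_cast
    ring
  have h3 : ∀ w : E3, ∫ x, g x * cexp (I * (inner ℝ x ((2 * Real.pi) • w) : ℝ)) =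
      (𝓕⁻ g : 𝓢(E3, ℂ)) w := by
    intro w
    rw [SchwartzMap.fourierInv_coe, Real.fourierInv_eq']
    refine integral_congr_ae (Eventually.of_forall fun x => ?_)
    simp only [inner_smul_right, smul_eq_mul]
    rw [mul_comm]
    congr 2
    push_cast
    ring
  simp only [h2, h3] at h1
  have h4 : ∫ w, 𝓕 P w * (𝓕⁻ g : 𝓢(E3, ℂ)) w = ∫ x, P x * g x := by
    have h5 : ∫ w, 𝓕 P w • (𝓕⁻ g : 𝓢(E3, ℂ)) w =
        ∫ x, P x • 𝓕 ((𝓕⁻ g : 𝓢(E3, ℂ)) : E3 → ℂ) x := by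
      simpa using! (VectorFourier.integral_fourierIntegral_smul_eq_flip (L := innerₗ E3)
        Real.continuous_fourierChar continuous_inner hP (𝓕⁻ g : 𝓢(E3, ℂ)).integrable)
    rw [← SchwartzMap.fourier_coe, FourierTransform.fourier_fourierInv_eq] at h5
    simpa only [smul_eq_mul] using h5
  rw [h4] at h1
  rw [h1, finrank_euclideanSpace, Fintype.card_fin, abs_of_pos (by positivity)]
  rw [real_smul, ← mul_assoc]
  have : ((2 * Real.pi : ℝ) : ℂ) ≠ 0 := ofReal_ne_zero.2 (by positivity)
  push_cast at this ⊢
  rw [mul_inv_cancel₀ (pow_ne_zero _ this), one_mul]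

section Pairing

variable {T : ℝ} [Fact (0 < T)] {ψ : AddCircle T → E3 → ℂ}

lemma integrable_test (h : IsSchwartzBruhat T ψ) :
    Integrable (fun z : AddCircle T × E3 => ψ z.1 z.2) (haarG T) := by
  obtain ⟨B, hB0, hB⟩ := h.exists_schwartz
  have hint := (integrable_one_add_norm (E := E3) (μ := volume) (r := 4)
    (by simp; norm_num)).comp_snd (AddCircle.haarAddCircle (T := T))
  set D := ∑ p ∈ Finset.Iic ((4, 0) : ℕ × ℕ), B p.1 p.2 with hD
  refine (hint.const_mul (2 ^ 4 * D)).mono' h.continuous.aestronglyMeasurable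
    (Eventually.of_forall fun z => ?_)
  obtain ⟨g, hg, hs⟩ := hB z.1
  rw [← hg]
  refine (schwartz_norm_le_of_seminorm g z.2).trans ?_
  gcongr
  refine Seminorm.finset_sup_apply_le (Finset.sum_nonneg fun p _ => hB0 _ _) fun p hp =>
    (hs p.1 p.2).trans ?_
  exact Finset.single_le_sum (f := fun p : ℕ × ℕ => B p.1 p.2) (fun p _ => hB0 _ _) hp

lemma integrable_mode_mul_test {P : E3 → ℂ} (hP : Integrable P) (h : IsSchwartzBruhat T ψ)
    (k : ℤ) :
    Integrable (fun z : AddCircle T × E3 => fourier k z.1 * P z.2 * ψ z.1 z.2) (haarG T) := by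
  obtain ⟨B, -, hB⟩ := h.exists_norm_le
  have h1 := hP.comp_snd (AddCircle.haarAddCircle (T := T))
  refine Integrable.mul_bdd (c := B) ?_ h.continuous.aestronglyMeasurable
    (Eventually.of_forall fun z => hB _ _)
  refine h1.bdd_mul (c := 1) (Continuous.aestronglyMeasurable (by fun_prop))
    (Eventually.of_forall fun z => (norm_fourier_apply k z.1).le)

/-- The `k`-th term of the inverse Fourier transform, for a symbol that is the Fourier transform
of an integrable function. -/
lemma mode_pairing {P : E3 → ℂ} (hP : Integrable P) {m : E3 → ℂ}
    (hm : ∀ ξ, m ξ = ∫ x, P x * cexp (-(I * (inner ℝ x ξ : ℝ)))) (h : IsSchwartzBruhat T ψ)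
    (k : ℤ) :
    ((2 * Real.pi : ℝ) ^ 3 : ℂ)⁻¹ * ∫ ξ : E3, m ξ * fourierG T ψ (-k) (-ξ) =
      ∫ z, fourier k z.1 * P z.2 * ψ z.1 z.2 ∂(haarG T) := by
  have hpi := Real.pi_pos
  set ν := AddCircle.haarAddCircle (T := T) with hν
  set H : AddCircle T → E3 → ℂ := fun t ξ => ∫ x, ψ t x * cexp (I * (inner ℝ x ξ : ℝ)) with hH
  have hψc := h.continuous
  have hF : ∀ ξ, fourierG T ψ (-k) (-ξ) = ∫ t, fourier k t * H t ξ ∂ν := by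
    intro ξ
    have hi : Integrable (fun z : AddCircle T × E3 => ψ z.1 z.2 *
        (fourier k z.1 * cexp (I * (inner ℝ z.2 ξ : ℝ)))) (ν.prod volume) := by
      refine (integrable_test h).mul_bdd (c := 1)
        (Continuous.aestronglyMeasurable (by fun_prop)) (Eventually.of_forall fun z => ?_)
      rw [norm_mul, norm_fourier_apply, one_mul, Complex.norm_exp]
      simp
    have e : fourierG T ψ (-k) (-ξ) = ∫ z, ψ z.1 z.2 *
        (fourier k z.1 * cexp (I * (inner ℝ z.2 ξ : ℝ))) ∂(ν.prod volume) := by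
      simp only [fourierG, neg_neg, inner_neg_right, ofReal_neg, mul_neg]
      rfl
    rw [e, integral_prod _ hi]
    refine integral_congr_ae (Eventually.of_forall fun t => ?_)
    simp only [hH]
    rw [← integral_const_mul]
    refine integral_congr_ae (Eventually.of_forall fun x => ?_)
    simp only
    ring
  obtain ⟨B, hB0, hB⟩ := h.exists_schwartz
  choose g hg hs using hB
  obtain ⟨D, hD⟩ := exists_fourierInv_bound hB0 hs
  -- As `m` is merely bounded, Fubini in (ξ, t) needs decay of the transformed slices that is
  -- uniform in t.
  have hHb : ∀ t ξ, ‖H t ξ‖ ≤ D * (1 + ‖(2 * Real.pi)⁻¹ • ξ‖) ^ (-(4 : ℝ)) := by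
    intro t ξ
    refine le_trans (le_of_eq ?_) (hD t ((2 * Real.pi)⁻¹ • ξ))
    rw [Real.fourierInv_eq']
    congr 1
    refine integral_congr_ae (Eventually.of_forall fun x => ?_)
    simp only [inner_smul_right, smul_eq_mul, hg]
    rw [mul_comm]
    congr 2
    push_cast
    have : (Real.pi : ℂ) ≠ 0 := ofReal_ne_zero.2 Real.pi_ne_zero
    field_simp
  have hmb : ∀ ξ, ‖m ξ‖ ≤ ∫ x, ‖P x‖ := by
    intro ξ
    rw [hm]
    refine (norm_integral_le_integral_norm _).trans (le_of_eq ?_)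
    refine integral_congr_ae (Eventually.of_forall fun x => ?_)
    simp only [norm_mul, Complex.norm_exp]
    simp
  have hmm : AEStronglyMeasurable m volume := by
    have : m = fun ξ => ∫ x, P x * cexp (-(I * (inner ℝ x ξ : ℝ))) := funext hm
    rw [this]
    have hae : AEStronglyMeasurable (fun p : E3 × E3 => P p.2 *
        cexp (-(I * (inner ℝ p.2 p.1 : ℝ)))) (volume.prod volume) :=
      (hP.aestronglyMeasurable.comp_snd).mul (Continuous.aestronglyMeasurable (by fun_prop))
    exact hae.integral_prod_right'
  have hHm : AEStronglyMeasurable (fun p : AddCircle T × E3 => H p.1 p.2) (ν.prod volume) := by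
    have hsm : StronglyMeasurable (fun p : (AddCircle T × E3) × E3 => ψ p.1.1 p.2 *
        cexp (I * (inner ℝ p.2 p.1.2 : ℝ))) := by
      refine Continuous.stronglyMeasurable ?_
      have : Continuous fun p : (AddCircle T × E3) × E3 => ψ p.1.1 p.2 :=
        hψc.comp (f := fun p : (AddCircle T × E3) × E3 => (p.1.1, p.2)) (by fun_prop)
      fun_prop
    exact (hsm.integral_prod_right').aestronglyMeasurable
  have hint : Integrable (Function.uncurry fun (ξ : E3) (t : AddCircle T) =>
      m ξ * (fourier k t * H t ξ)) (volume.prod ν) := by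
    have h4 : Integrable fun ξ : E3 => (1 + ‖(2 * Real.pi)⁻¹ • ξ‖) ^ (-(4 : ℝ)) :=
      (integrable_one_add_norm (E := E3) (μ := volume) (r := 4)
        (by simp; norm_num)).comp_smul (by positivity)
    have h5 := ((h4.const_mul D).const_mul (∫ x, ‖P x‖)).comp_fst ν
    refine h5.mono' ?_ (Eventually.of_forall fun p => ?_)
    · refine (hmm.comp_fst).mul (AEStronglyMeasurable.mul
        (Continuous.aestronglyMeasurable (by fun_prop)) ?_)
      exact hHm.prod_swap
    · simp only [Function.uncurry, norm_mul, norm_fourier_apply, one_mul]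
      gcongr
      · exact hmb _
      · exact hHb _ _
  have hswap : ∫ ξ : E3, m ξ * fourierG T ψ (-k) (-ξ) =
      ∫ t, ∫ ξ, m ξ * (fourier k t * H t ξ) ∂volume ∂ν := by
    rw [← integral_integral_swap hint]
    simp_rw [hF, ← integral_const_mul]
  rw [hswap]
  have hinner : ∀ t, ∫ ξ, m ξ * (fourier k t * H t ξ) =
      fourier k t * (((2 * Real.pi : ℝ) ^ 3 : ℂ) * ∫ x, P x * ψ t x) := by
    intro t
    have h6 := integral_fourier_mul_schwartz hP hm (g t)
    simp only [hg] at h6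
    rw [← h6, ← integral_const_mul]
    refine integral_congr_ae (Eventually.of_forall fun ξ => ?_)
    simp only [hH]; ring
  simp_rw [hinner]
  have h7 : ((2 * Real.pi : ℝ) ^ 3 : ℂ) ≠ 0 :=
    pow_ne_zero _ (ofReal_ne_zero.2 (by positivity))
  have hi := integrable_mode_mul_test hP h k
  rw [haarG] at hi ⊢
  rw [integral_prod _ hi, ← integral_const_mul]
  refine integral_congr_ae (Eventually.of_forall fun t => ?_)
  simp only
  rw [mul_left_comm, inv_mul_cancel_left₀ h7, ← integral_const_mul]
  refine integral_congr_ae (Eventually.of_forall fun x => ?_)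
  simp only [mul_assoc]

end Pairing

/-! ### The symbol as Fourier transform of a mode. -/

lemma fourier_mode {lam T : ℝ} (hlam : 0 < lam) (hT : 0 < T) {k : ℤ} (hk : k ≠ 0) (ξ : E3) :
    symbolPerp lam T k ξ =
      ∫ x, mode (lam / 2) (2 * Real.pi / T) k x * cexp (-(I * (inner ℝ x ξ : ℝ))) := by
  have hpi := Real.pi_pos
  have ha : 0 < lam / 2 := by positivity
  have hϖ : 0 < 2 * Real.pi / T := by positivity
  obtain ⟨c, hc, hgap⟩ := exists_massRe_ge ha hϖ
  have hk1 := one_le_abs_intCast hk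
  have hμ : lam / 2 < (mass (lam / 2) (2 * Real.pi / T * k)).re := by
    have h1 := hgap k hk
    have h2 : 0 < c * √|(k : ℝ)| := mul_pos hc (Real.sqrt_pos.2 (by linarith))
    simp only [mass]
    linarith
  set μ := mass (lam / 2) (2 * Real.pi / T * k) with hμdef
  -- Drift and Fourier phase form one complex linear exponent ζ = -a e₁ - iξ, for which μ² - Σζᵢ² is
  -- the denominator of the symbol. Convergence requires |Re ζ| = a < Re μ, which is the gap.
  set ζ : Fin 3 → ℂ := fun i => -((if i = 0 then lam / 2 else 0 : ℝ) : ℂ) - I * ξ i with hζ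
  have hre : ∀ i, (ζ i).re = -(if i = 0 then lam / 2 else 0) := by
    intro i
    simp only [hζ, sub_re, neg_re, ofReal_re, I_mul_re, ofReal_im, neg_zero, sub_zero]
  have hY := yukawa_fourier ha.le (ζ := ζ)
    (by
      intro x
      simp only [hre, Fin.sum_univ_three, Fin.isValue, ↓reduceIte, one_ne_zero, Fin.reduceEq]
      have h3 := abs_coord_le x 0
      have h4 := neg_abs_le (x 0)
      nlinarith)
    (by simp only [hre, Fin.sum_univ_three, Fin.isValue, ↓reduceIte, one_ne_zero, Fin.reduceEq]
        norm_num) hμ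
  have hden : μ ^ 2 - ∑ i, ζ i ^ 2 = (‖ξ‖ ^ 2 : ℝ) - I * (lam * ξ 0 : ℝ) +
      I * (2 * Real.pi / T * k : ℝ) := by
    rw [hμdef, mass_sq ha, EuclideanSpace.norm_sq_eq]
    simp only [hζ, Fin.sum_univ_three, Fin.isValue, ↓reduceIte, one_ne_zero, Fin.reduceEq,
      Real.norm_eq_abs, sq_abs]
    push_cast
    ring_nf
    simp only [I_sq]
    ring
  have hint : ∫ x, mode (lam / 2) (2 * Real.pi / T) k x * cexp (-(I * (inner ℝ x ξ : ℝ))) =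
      (4 * Real.pi : ℂ)⁻¹ * ∫ x : E3, cexp (-μ * ‖x‖) / ‖x‖ * cexp (∑ i, ζ i * x i) := by
    rw [← integral_const_mul]
    refine integral_congr_ae (Eventually.of_forall fun x => ?_)
    simp only
    rw [mode, if_neg hk, modeExp, ← hμdef, sub_eq_add_neg, Complex.exp_add]
    have e : cexp (∑ i, ζ i * x i) =
        cexp (-(((lam / 2 : ℝ) : ℂ) * x 0)) * cexp (-(I * (inner ℝ x ξ : ℝ))) := by
      rw [← Complex.exp_add]
      congr 1
      simp only [hζ, PiLp.inner_apply, RCLike.inner_apply, conj_trivial, Fin.sum_univ_three,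
        Fin.isValue, ↓reduceIte, one_ne_zero, Fin.reduceEq]
      push_cast
      ring
    rw [e]
    push_cast
    rw [mul_inv]
    ring
  rw [hint, symbolPerp, if_neg hk, sub_zero, ← hden]
  have hpi' : (Real.pi : ℂ) ≠ 0 := ofReal_ne_zero.2 hpi.ne'
  have hne : μ ^ 2 - ∑ i, ζ i ^ 2 ≠ 0 := by
    intro h0
    rw [h0, mul_zero] at hY
    have : (4 * Real.pi : ℂ) ≠ 0 := mul_ne_zero (by norm_num) hpi'
    exact this hY.symm
  rw [div_eq_iff hne, mul_assoc, hY, inv_mul_cancel₀ (mul_ne_zero (by norm_num) hpi')]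

/-! ### Interchanging the sum over frequencies with the pairing. -/

namespace IsAdmissible

variable {m : ℕ} {b C : ℝ} {Q : ℤ → E3 → ℂ}

lemma aestronglyMeasurable (h : IsAdmissible m b C Q) (k : ℤ) :
    AEStronglyMeasurable (Q k) volume := by
  have h1 := (h.cont k).aestronglyMeasurable (μ := volume) (measurableSet_singleton 0).compl
  rwa [Measure.restrict_eq_self_of_ae_mem] at h1
  simp [ae_iff]

/-- A bound for the modes that is integrable in space and, once divided by `|k|`, summable. -/
lemma norm_le_rpow (h : IsAdmissible m b C Q) {k : ℤ} (hk : k ≠ 0) {x : E3} (hx : x ≠ 0) :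
    ‖Q k x‖ ≤ C * (b / 2) ^ (-(1 / 2) : ℝ) * |(k : ℝ)| ^ (-(1 / 4) : ℝ) *
      (‖x‖ ^ (-(m + 3 / 2) : ℝ) * Real.exp (-(b / 2 * ‖x‖))) := by
  have hb := h.b_pos
  have hC := h.C_nonneg
  have hr : 0 < ‖x‖ := norm_pos_iff.2 hx
  have hk1 := one_le_abs_intCast hk
  have hk0 : 0 < |(k : ℝ)| := by linarith
  have h1 := (h.bound k x hk hx).trans
    (mul_le_mul_of_nonneg_left (exp_neg_mul_sqrt_le hb hr hk1) (by positivity))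
  refine h1.trans ?_
  set y : ℝ := b * ‖x‖ / 2 * √|(k : ℝ)| with hy
  have hy0 : 0 < y := mul_pos (by positivity) (Real.sqrt_pos.2 hk0)
  -- Trades decay for |k|^(-1/4) at the price ‖x‖^(-1/2). For m = 1 the singularity becomes
  -- ‖x‖^(-5/2), still integrable in ℝ³, and |k|^(-1/4)·|k|⁻¹ is summable.
  have h2 : Real.exp (-y) ≤ y ^ (-(1 / 2) : ℝ) := by
    rw [Real.exp_neg, Real.rpow_neg hy0.le, ← Real.sqrt_eq_rpow]
    gcongr
    have h3 := Real.add_one_le_exp y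
    have h4 : √y ≤ 1 + y := by
      rw [Real.sqrt_le_left (by positivity)]; nlinarith
    linarith
  have h5 : y ^ (-(1 / 2) : ℝ) = (b / 2) ^ (-(1 / 2) : ℝ) * |(k : ℝ)| ^ (-(1 / 4) : ℝ) *
      ‖x‖ ^ (-(1 / 2) : ℝ) := by
    rw [hy, show b * ‖x‖ / 2 = b / 2 * ‖x‖ by ring, Real.mul_rpow (by positivity) (by positivity),
      Real.mul_rpow (by positivity) (by positivity), Real.sqrt_eq_rpow, ← Real.rpow_mul hk0.le]
    norm_num
    ring
  have h6 : ‖x‖ ^ (-(m + 3 / 2) : ℝ) = (‖x‖ ^ (m + 1))⁻¹ * ‖x‖ ^ (-(1 / 2) : ℝ) := by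
    rw [← Real.rpow_natCast, ← Real.rpow_neg hr.le, ← Real.rpow_add hr]
    congr 1
    push_cast
    ring
  calc _ ≤ C / ‖x‖ ^ (m + 1) * (Real.exp (-(b / 2 * ‖x‖)) * y ^ (-(1 / 2) : ℝ)) := by gcongr
    _ = _ := by rw [h5, h6]; ring

lemma integrable (h : IsAdmissible m b C Q) (hm : m ≤ 1) (k : ℤ) : Integrable (Q k) := by
  by_cases hk : k = 0
  · subst hk
    have : Q 0 = fun _ => 0 := funext h.zero
    rw [this]; exact integrable_zero _ _ _
  have hm' : (m : ℝ) ≤ 1 := by exact_mod_cast hm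
  have h1 := (integrable_norm_rpow_mul_exp (s := m + 3 / 2) (c := b / 2) (by linarith)
    (by linarith [h.b_pos])).const_mul (C * (b / 2) ^ (-(1 / 2) : ℝ) * |(k : ℝ)| ^ (-(1 / 4) : ℝ))
  refine h1.mono' (h.aestronglyMeasurable k) ?_
  have h0 : ∀ᵐ x : E3, x ≠ 0 := by simp [ae_iff]
  filter_upwards [h0] with x hx
  exact h.norm_le_rpow hk hx

end IsAdmissible

lemma IsSchwartzBruhat.pdx {T : ℝ} {ψ : AddCircle T → E3 → ℂ} (h : IsSchwartzBruhat T ψ)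
    (j : Fin 3) : IsSchwartzBruhat T (pdx j ψ) := by
  set e : ℝ × E3 := (0, EuclideanSpace.single j 1) with he
  set A : (ℝ × E3 →L[ℝ] ℂ) →L[ℝ] ℂ := ContinuousLinearMap.apply ℝ ℂ e with hA
  have hfun : lift T (TimePeriodic.pdx j ψ) = fun z => A (fderiv ℝ (lift T ψ) z) := by
    ext z
    have h1 : HasFDerivAt (lift T ψ) (fderiv ℝ (lift T ψ) z) z :=
      (h.1.differentiable (by simp) z).hasFDerivAt
    have h2 : HasFDerivAt (fun x : E3 => (z.1, x)) (ContinuousLinearMap.inr ℝ ℝ E3) z.2 :=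
      hasFDerivAt_prodMk_right z.1 z.2
    have h3 : HasFDerivAt (ψ (z.1 : AddCircle T))
        ((fderiv ℝ (lift T ψ) z).comp (ContinuousLinearMap.inr ℝ ℝ E3)) z.2 :=
      HasFDerivAt.comp (g := lift T ψ) (f := fun x : E3 => (z.1, x)) z.2 h1 h2
    rw [lift, TimePeriodic.pdx, h3.fderiv]
    simp [hA, he]
  have hcd : ContDiff ℝ ∞ (fderiv ℝ (lift T ψ)) := h.1.fderiv_right (by simp)
  constructor
  · rw [hfun]; exact A.contDiff.comp hcd
  · intro k n
    obtain ⟨C, hC⟩ := h.2 k (n + 1)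
    refine ⟨‖A‖ * C, fun z => ?_⟩
    rw [hfun]
    have h4 := A.norm_iteratedFDeriv_comp_left (f := fderiv ℝ (lift T ψ)) (x := z)
      hcd.contDiffAt (n := n) (by exact_mod_cast le_top)
    rw [norm_iteratedFDeriv_fderiv] at h4
    calc _ ≤ ‖z.2‖ ^ k * (‖A‖ * ‖iteratedFDeriv ℝ (n + 1) (lift T ψ) z‖) := by
          gcongr
          exact h4
      _ = ‖A‖ * (‖z.2‖ ^ k * ‖iteratedFDeriv ℝ (n + 1) (lift T ψ) z‖) := by ring
      _ ≤ _ := by gcongr; exact hC z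

/-- Decay of the Fourier coefficients in time of a test function. -/
lemma IsSchwartzBruhat.exists_coeff_bound {T : ℝ} [hT : Fact (0 < T)] {ψ : AddCircle T → E3 → ℂ}
    (h : IsSchwartzBruhat T ψ) : ∃ D, 0 ≤ D ∧ ∀ (k : ℤ) (x : E3), k ≠ 0 →
      ‖∫ t, fourier k t * ψ t x ∂AddCircle.haarAddCircle‖ ≤ D / |(k : ℝ)| := by
  obtain ⟨D, hD⟩ := h.2 0 1
  have hT0 : 0 < T := hT.out
  have hpi := Real.pi_pos
  have hD0 : 0 ≤ D := le_trans (by positivity) (hD 0)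
  refine ⟨T * D / (2 * Real.pi), by positivity, fun k x hk => ?_⟩
  have hk1 := one_le_abs_intCast hk
  set f : ℝ → ℂ := fun s => lift T ψ (s, x) with hf
  set f' : ℝ → ℂ := fun s => fderiv ℝ (lift T ψ) (s, x) (1, 0) with hf'
  have hfd : ∀ s, HasDerivAt f (f' s) s := by
    intro s
    have h1 : HasFDerivAt (lift T ψ) (fderiv ℝ (lift T ψ) (s, x)) (s, x) :=
      (h.1.differentiable (by simp) (s, x)).hasFDerivAt
    have h2 : HasDerivAt (fun s : ℝ => (s, x)) ((1 : ℝ), (0 : E3)) s :=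
      (hasDerivAt_id s).prodMk (hasDerivAt_const s x)
    exact h1.comp_hasDerivAt s h2
  have hf'c : Continuous f' := by
    have : Continuous (fderiv ℝ (lift T ψ)) := h.1.continuous_fderiv (by simp)
    fun_prop
  have hf'b : ∀ s, ‖f' s‖ ≤ D := by
    intro s
    have h1 := hD (s, x)
    rw [pow_zero, one_mul, norm_iteratedFDeriv_one] at h1
    refine (ContinuousLinearMap.le_opNorm _ _).trans ?_
    have : ‖((1 : ℝ), (0 : E3))‖ = 1 := by simp [Prod.norm_def]
    rw [this, mul_one]
    exact h1
  set v : ℝ → ℂ := fun y => (T : ℂ) / (-2 * Real.pi * I * (-k : ℤ)) *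
    fourier (-(-k)) (y : AddCircle T) with hv
  have hvd : ∀ s : ℝ, HasDerivAt v (fourier (-(-k)) (s : AddCircle T)) s := fun s =>
    has_antideriv_at_fourier_neg hT (neg_ne_zero.2 hk) s
  have hvc : Continuous fun s : ℝ => fourier (-(-k)) (s : AddCircle T) :=
    (map_continuous _).comp (AddCircle.continuous_mk' T)
  -- One integration by parts over a period gains 1/|k|; the boundary terms cancel by periodicity.
  have hparts := intervalIntegral.integral_mul_deriv_eq_deriv_mul (a := 0) (b := T)
    (fun s _ => hfd s) (fun s _ => hvd s) (hf'c.intervalIntegrable _ _)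
    (hvc.intervalIntegrable _ _)
  have hper : f T * v T - f 0 * v 0 = 0 := by
    have e0 : ((T : ℝ) : AddCircle T) = ((0 : ℝ) : AddCircle T) := by
      rw [AddCircle.coe_period]; rfl
    have e1 : f T = f 0 := by simp only [hf, lift, e0]
    have e2 : v T = v 0 := by simp only [hv, e0]
    rw [e1, e2, sub_self]
  rw [hper, zero_sub] at hparts
  have hvn : ∀ s, ‖v s‖ = T / (2 * Real.pi * |(k : ℝ)|) := by
    intro s
    simp only [hv, norm_mul, norm_fourier_apply, mul_one, norm_div, Complex.norm_real,
      Real.norm_eq_abs, abs_of_pos hT0, norm_neg, Complex.norm_ofNat, abs_of_pos hpi, norm_I]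
    push_cast
    rw [norm_neg, Complex.norm_intCast]
  have hint : ∫ t, fourier k t * ψ t x ∂AddCircle.haarAddCircle =
      T⁻¹ • ∫ s in (0 : ℝ)..T, f s * fourier (-(-k)) (s : AddCircle T) := by
    rw [AddCircle.integral_haarAddCircle, ← AddCircle.intervalIntegral_preimage T 0, zero_add,
      neg_neg]
    congr 1
    refine intervalIntegral.integral_congr fun s _ => ?_
    simp only [hf, lift]
    ring
  rw [hint, hparts, norm_smul, norm_neg, Real.norm_of_nonneg (by positivity)]
  have hb := intervalIntegral.norm_integral_le_of_norm_le_const (a := 0) (b := T)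
    (f := fun s => f' s * v s) (C := D * (T / (2 * Real.pi * |(k : ℝ)|))) fun s _ => by
      rw [norm_mul, hvn]
      gcongr
      exact hf'b s
  rw [sub_zero, abs_of_pos hT0] at hb
  calc _ ≤ T⁻¹ * (D * (T / (2 * Real.pi * |(k : ℝ)|)) * T) := by gcongr
    _ = _ := by field_simp

lemma ae_ne_zero : ∀ᵐ x : E3, x ≠ 0 := by simp [ae_iff]

section Interchange

variable {T : ℝ} [Fact (0 < T)] {m : ℕ} {b C : ℝ} {Q : ℤ → E3 → ℂ} {ψ : AddCircle T → E3 → ℂ}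

lemma ae_haarG_snd_ne_zero : ∀ᵐ z ∂(haarG T), z.2 ≠ 0 :=
  Measure.quasiMeasurePreserving_snd.ae ae_ne_zero

lemma integrable_fourier_weight :
    Integrable (fun t : AddCircle T => ‖fourier 1 t - 1‖ ^ (-(1 - 1 / 4) : ℝ))
      AddCircle.haarAddCircle := by
  rw [← memLp_one_iff_integrable]
  refine ⟨(Measurable.pow_const ?_ _).aestronglyMeasurable, ?_⟩
  · exact (((map_continuous (fourier 1)).sub continuous_const).norm).measurable
  · have := eLpNorm_fourier_weight_lt_top (T := T) (γ := 1 / 4) (q := 1) (by norm_num) le_rfl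
      (by norm_num)
    simpa using this

lemma IsAdmissible.aestronglyMeasurable_modeSum (h : IsAdmissible m b C Q) :
    AEStronglyMeasurable (fun z : AddCircle T × E3 => modeSum Q z.1 z.2) (haarG T) := by
  have hm : MeasurableSet {z : AddCircle T × E3 | z.2 ≠ 0} :=
    (measurableSet_singleton (0 : E3)).compl.preimage measurable_snd
  have h1 := (h.continuousOn_modeSum T).aestronglyMeasurable (μ := haarG T) hm
  rwa [Measure.restrict_eq_self_of_ae_mem] at h1
  exact ae_haarG_snd_ne_zero

/-- The bound ‖x‖^(-(m+3)) for the absolute sum is not integrable at the origin, so the interpolated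
bound is used. With γ = 1/4 its singularity is at most ‖x‖^(-5/2) for m ≤ 1, and its weight in time
is integrable. -/
lemma IsAdmissible.integrable_modeSum_mul (h : IsAdmissible m b C Q) (hm : m ≤ 1)
    (hψ : IsSchwartzBruhat T ψ) :
    Integrable (fun z : AddCircle T × E3 => modeSum Q z.1 z.2 * ψ z.1 z.2) (haarG T) := by
  have hm' : (m : ℝ) ≤ 1 := by exact_mod_cast hm
  obtain ⟨B, hB0, hB⟩ := hψ.exists_norm_le
  refine Integrable.mul_bdd (c := B) ?_ hψ.continuous.aestronglyMeasurable
    (Eventually.of_forall fun z => hB _ _)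
  have h1 := integrable_norm_rpow_mul_exp (s := m + 1 + 2 * (1 / 4)) (c := b / 2) (by linarith)
    (by linarith [h.b_pos])
  have h2 := ((integrable_fourier_weight (T := T)).mul_prod h1).const_mul
    (16 * C / b ^ 2 + (3 * C + 8 * C / b))
  refine h2.mono' h.aestronglyMeasurable_modeSum ?_
  have h3 : ∀ᵐ z ∂(haarG T), 0 < ‖fourier 1 z.1 - 1‖ :=
    Measure.quasiMeasurePreserving_fst.ae ae_fourier_one_ne_one
  filter_upwards [h3, ae_haarG_snd_ne_zero] with z hz1 hz2
  refine (h.norm_modeSum_le (γ := 1 / 4) (by norm_num) (by norm_num) hz2 hz1).trans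
    (le_of_eq ?_)
  ring

/-- Summation over the modes may be interchanged with the pairing against a test function. -/
lemma IsAdmissible.hasSum_pairing (h : IsAdmissible m b C Q) (hm : m ≤ 1)
    (hψ : IsSchwartzBruhat T ψ) :
    HasSum (fun k : ℤ => ∫ z, fourier k z.1 * Q k z.2 * ψ z.1 z.2 ∂(haarG T))
      (∫ z, modeSum Q z.1 z.2 * ψ z.1 z.2 ∂(haarG T)) := by
  have hm' : (m : ℝ) ≤ 1 := by exact_mod_cast hm
  have hb := h.b_pos
  have hC := h.C_nonneg
  set ν := AddCircle.haarAddCircle (T := T) with hν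
  -- Integrating in time first replaces ψ by its Fourier coefficients. Their decay 1/|k| is
  -- essential, as the bounds on the modes alone do not make the spatial L¹ norms summable.
  set c : ℤ → E3 → ℂ := fun k x => ∫ t, fourier k t * ψ t x ∂ν with hc
  obtain ⟨D, hD0, hD⟩ := hψ.exists_coeff_bound
  obtain ⟨B, hB0, hB⟩ := hψ.exists_norm_le
  have hcm : ∀ k, AEStronglyMeasurable (c k) volume := by
    intro k
    have hψc := hψ.continuous
    have hsm : StronglyMeasurable (fun p : E3 × AddCircle T => fourier k p.2 * ψ p.2 p.1) := by
      refine Continuous.stronglyMeasurable ?_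
      have : Continuous fun p : E3 × AddCircle T => ψ p.2 p.1 :=
        hψc.comp (f := fun p : E3 × AddCircle T => (p.2, p.1)) (by fun_prop)
      fun_prop
    exact (hsm.integral_prod_right').aestronglyMeasurable
  have hcb : ∀ k x, ‖c k x‖ ≤ B := by
    intro k x
    refine (norm_integral_le_of_norm_le_const (C := B) (Eventually.of_forall fun t => ?_)).trans ?_
    · rw [norm_mul, norm_fourier_apply, one_mul]; exact hB t x
    · simp
  have hterm : ∀ k : ℤ, ∫ z, fourier k z.1 * Q k z.2 * ψ z.1 z.2 ∂(haarG T) =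
      ∫ x, Q k x * c k x := by
    intro k
    have hi := integrable_mode_mul_test (h.integrable hm k) hψ k
    rw [haarG] at hi ⊢
    rw [integral_prod_symm _ hi]
    refine integral_congr_ae (Eventually.of_forall fun x => ?_)
    simp only [hc]
    rw [← integral_const_mul]
    refine integral_congr_ae (Eventually.of_forall fun t => ?_)
    simp only
    ring
  have htotal : ∫ z, modeSum Q z.1 z.2 * ψ z.1 z.2 ∂(haarG T) =
      ∫ x, ∑' k, Q k x * c k x := by
    have hi := h.integrable_modeSum_mul hm hψ
    rw [haarG] at hi ⊢
    rw [integral_prod_symm _ hi]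
    refine integral_congr_ae ?_
    filter_upwards [ae_ne_zero] with x hx
    have hψx : Continuous fun t => ψ t x :=
      hψ.continuous.comp (f := fun t : AddCircle T => (t, x)) (by fun_prop)
    have hcont : ∀ k : ℤ, Continuous fun t : AddCircle T => fourier k t * Q k x * ψ t x := by
      intro k; fun_prop
    have hnorm : ∀ (k : ℤ) (t : AddCircle T), ‖fourier k t * Q k x * ψ t x‖ ≤ ‖Q k x‖ * B := by
      intro k t
      rw [norm_mul, norm_mul, norm_fourier_apply, one_mul]
      gcongr
      exact hB t x
    have hints : ∀ k : ℤ, Integrable (fun t : AddCircle T => fourier k t * Q k x * ψ t x) ν :=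
      fun k => Integrable.of_bound (hcont k).aestronglyMeasurable (‖Q k x‖ * B)
        (Eventually.of_forall (hnorm k))
    have hs := (h.summable_tsum_le hx).1
    have hsum : Summable fun k : ℤ => ∫ t, ‖fourier k t * Q k x * ψ t x‖ ∂ν := by
      refine Summable.of_nonneg_of_le (fun k => integral_nonneg fun t => norm_nonneg _)
        (fun k => ?_) (hs.mul_right B)
      refine (integral_mono (hints k).norm (integrable_const (‖Q k x‖ * B)) (hnorm k)).trans ?_
      simp
    have h1 := (hasSum_integral_of_summable_integral_norm hints hsum).tsum_eq
    have h2 : ∀ t : AddCircle T, modeSum Q t x * ψ t x = ∑' k, fourier k t * Q k x * ψ t x := by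
      intro t
      rw [modeSum, tsum_mul_right]
    simp only [h2]
    rw [← h1]
    refine tsum_congr fun k => ?_
    simp only [hc]
    rw [← integral_const_mul]
    refine integral_congr_ae (Eventually.of_forall fun t => ?_)
    simp only
    ring
  simp only [hterm]
  rw [htotal]
  have hR := integrable_norm_rpow_mul_exp (s := m + 3 / 2) (c := b / 2) (by linarith)
    (by linarith)
  have hints : ∀ k : ℤ, Integrable fun x => Q k x * c k x := fun k =>
    (h.integrable hm k).mul_bdd (c := B) (hcm k) (Eventually.of_forall (hcb k))
  refine hasSum_integral_of_summable_integral_norm hints ?_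
  set J : ℝ := ∫ x : E3, ‖x‖ ^ (-(m + 3 / 2) : ℝ) * Real.exp (-(b / 2 * ‖x‖)) with hJ
  set A : ℝ := C * (b / 2) ^ (-(1 / 2) : ℝ) * D with hA
  have hS := (Real.summable_abs_int_rpow (b := 5 / 4) (by norm_num)).mul_left (A * J)
  refine Summable.of_nonneg_of_le (fun k => integral_nonneg fun t => norm_nonneg _)
    (fun k => ?_) hS
  by_cases hk : k = 0
  · subst hk
    simp [h.zero]
  have hk1 := one_le_abs_intCast hk
  have hk0 : 0 < |(k : ℝ)| := by linarith
  have hle : ∫ x, ‖Q k x * c k x‖ ≤ ∫ x : E3, A * |(k : ℝ)| ^ (-(5 / 4) : ℝ) *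
      (‖x‖ ^ (-(m + 3 / 2) : ℝ) * Real.exp (-(b / 2 * ‖x‖))) := by
    refine integral_mono_ae (hints k).norm (hR.const_mul _) ?_
    filter_upwards [ae_ne_zero] with x hx
    rw [norm_mul]
    calc _ ≤ C * (b / 2) ^ (-(1 / 2) : ℝ) * |(k : ℝ)| ^ (-(1 / 4) : ℝ) *
          (‖x‖ ^ (-(m + 3 / 2) : ℝ) * Real.exp (-(b / 2 * ‖x‖))) * (D / |(k : ℝ)|) := by
          gcongr
          · exact h.norm_le_rpow hk hx
          · exact hD k x hk
      _ = A * (|(k : ℝ)| ^ (-(1 / 4) : ℝ) * |(k : ℝ)| ^ (-1 : ℝ)) *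
          (‖x‖ ^ (-(m + 3 / 2) : ℝ) * Real.exp (-(b / 2 * ‖x‖))) := by
          rw [Real.rpow_neg_one, hA]; ring
      _ = _ := by rw [← Real.rpow_add hk0]; norm_num
  refine hle.trans (le_of_eq ?_)
  rw [integral_const_mul, ← hJ]
  ring

end Interchange

/-! ### Integration by parts across the singularity. -/

/-- The screened potential as a function of the radius and the position. -/
def screened (μ : ℂ) (a ρ : ℝ) (x : E3) : ℂ :=
  (((4 * Real.pi * ρ : ℝ) : ℂ))⁻¹ * cexp (-μ * ρ - a * x 0)

/-- The partial derivatives of the screened potential. -/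
def screenedGrad (μ : ℂ) (a : ℝ) (j : Fin 3) (ρ : ℝ) (x : E3) : ℂ :=
  screened μ a ρ x * ((-(if j = 0 then a else 0) - x j / ρ ^ 2 : ℝ) - μ * (x j / ρ : ℝ))

/-- Uniformity in ρ ≥ ‖x‖ makes the right-hand side a dominating function for all regularised radii
at once. -/
lemma norm_screened_le {μ : ℂ} {a ρ : ℝ} (ha : 0 < a) (hμ : a < μ.re) {x : E3} (hx : x ≠ 0)
    (hρ : ‖x‖ ≤ ρ) :
    ‖screened μ a ρ x‖ ≤ ‖x‖⁻¹ * Real.exp (-((μ.re - a) * ‖x‖)) := by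
  have hr : 0 < ‖x‖ := norm_pos_iff.2 hx
  have hρ0 : 0 < ρ := hr.trans_le hρ
  have hpi := Real.pi_gt_three
  rw [screened, norm_mul, norm_inv, Complex.norm_real, Real.norm_of_nonneg (by positivity),
    Complex.norm_exp]
  gcongr
  · nlinarith
  · have h1 : (-μ * ρ - a * x 0 : ℂ).re = -μ.re * ρ - a * x 0 := by
      rw [sub_re, re_mul_ofReal, neg_re, ← ofReal_mul, ofReal_re]
    rw [h1]
    have h3 := abs_coord_le x 0
    have h4 := neg_abs_le (x 0)
    nlinarith

lemma norm_screenedGrad_le {μ : ℂ} {a ρ : ℝ} (ha : 0 < a) (hμ : a < μ.re) (j : Fin 3) {x : E3}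
    (hx : x ≠ 0) (hρ : ‖x‖ ≤ ρ) :
    ‖screenedGrad μ a j ρ x‖ ≤ ‖x‖⁻¹ * Real.exp (-((μ.re - a) * ‖x‖)) *
      (a + ‖x‖⁻¹ + ‖μ‖) := by
  have hr : 0 < ‖x‖ := norm_pos_iff.2 hx
  have hρ0 : 0 < ρ := hr.trans_le hρ
  have h1 : |x j / ρ| ≤ 1 := by
    rw [abs_div, abs_of_pos hρ0, div_le_one hρ0]
    exact (abs_coord_le x j).trans hρ
  have h2 : |x j / ρ ^ 2| ≤ ‖x‖⁻¹ := by
    rw [sq, ← div_div, abs_div, abs_of_pos hρ0, div_eq_mul_inv]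
    calc _ ≤ 1 * ρ⁻¹ := by gcongr
      _ ≤ ‖x‖⁻¹ := by rw [one_mul]; gcongr
  have h3 : |-(if j = 0 then a else 0)| ≤ a := by
    rw [abs_neg]; split_ifs
    · exact (abs_of_pos ha).le
    · simpa using ha.le
  rw [screenedGrad, norm_mul]
  gcongr
  · exact norm_screened_le ha hμ hx hρ
  · refine (norm_sub_le _ _).trans ?_
    rw [norm_mul, Complex.norm_real, Complex.norm_real]
    refine add_le_add ((abs_sub _ _).trans (add_le_add h3 h2)) ?_
    exact mul_le_of_le_one_right (norm_nonneg _) h1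

lemma measurable_screened (μ : ℂ) (a : ℝ) : Measurable fun p : ℝ × E3 => screened μ a p.1 p.2 := by
  unfold screened; fun_prop

lemma measurable_screenedGrad (μ : ℂ) (a : ℝ) (j : Fin 3) :
    Measurable fun p : ℝ × E3 => screenedGrad μ a j p.1 p.2 := by
  unfold screenedGrad
  have := measurable_screened μ a
  fun_prop

lemma continuousAt_screened (μ : ℂ) (a : ℝ) {ρ : ℝ} (hρ : 0 < ρ) (x : E3) :
    ContinuousAt (fun ρ => screened μ a ρ x) ρ := by
  have h : ((4 * Real.pi * ρ : ℝ) : ℂ) ≠ 0 :=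
    ofReal_ne_zero.2 (by have := Real.pi_pos; positivity)
  unfold screened
  exact ContinuousAt.mul (ContinuousAt.inv₀ (by fun_prop) h) (by fun_prop)

lemma continuousAt_screenedGrad (μ : ℂ) (a : ℝ) (j : Fin 3) {ρ : ℝ} (hρ : 0 < ρ) (x : E3) :
    ContinuousAt (fun ρ => screenedGrad μ a j ρ x) ρ := by
  unfold screenedGrad
  refine (continuousAt_screened μ a hρ x).mul (ContinuousAt.sub ?_ (continuousAt_const.mul ?_))
  · refine continuous_ofReal.continuousAt.comp (continuousAt_const.sub ?_)
    exact ContinuousAt.div (by fun_prop) (by fun_prop) (by positivity)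
  · refine continuous_ofReal.continuousAt.comp ?_
    exact ContinuousAt.div (by fun_prop) (by fun_prop) hρ.ne'

/-- Integration by parts against the screened potential, across its singularity. -/
lemma integral_screened_mul_fderiv {μ : ℂ} {a : ℝ} (ha : 0 < a) (hμ : a < μ.re) (j : Fin 3)
    {g : E3 → ℂ} (hg : Differentiable ℝ g) {g' : E3 → ℂ}
    (hg' : ∀ x, g' x = fderiv ℝ g x (EuclideanSpace.single j 1)) (hgc : Continuous g')
    {B B' : ℝ} (hB : ∀ x, ‖g x‖ ≤ B) (hB' : ∀ x, ‖g' x‖ ≤ B') :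
    ∫ x, screened μ a ‖x‖ x * g' x = -∫ x, screenedGrad μ a j ‖x‖ x * g x := by
  -- Replacing ‖x‖ by √(‖x‖² + ε²) removes the singularity, so integration by parts holds on all of
  -- ℝ³. Since the gradients are dominated by an integrable function of order ‖x‖⁻² at the origin,
  -- no point mass survives as ε → 0.
  set ε : ℕ → ℝ := fun n => 1 / ((n : ℝ) + 1) with hε
  have hε0 : ∀ n, 0 < ε n := fun n => by positivity
  have hεt : Tendsto ε atTop (𝓝 0) := tendsto_one_div_add_atTop_nhds_zero_nat
  set R : ℕ → E3 → ℝ := fun n x => √(‖x‖ ^ 2 + ε n ^ 2) with hR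
  have hRc : ∀ n, Continuous (R n) := fun n => by simp only [hR]; fun_prop
  have hRge : ∀ n x, ‖x‖ ≤ R n x := fun n x => Real.le_sqrt_of_sq_le (by
    have := sq_nonneg (ε n); linarith)
  have hRt : ∀ x, Tendsto (fun n => R n x) atTop (𝓝 ‖x‖) := by
    intro x
    have h1 : Tendsto (fun n => ‖x‖ ^ 2 + ε n ^ 2) atTop (𝓝 (‖x‖ ^ 2 + 0 ^ 2)) :=
      tendsto_const_nhds.add (hεt.pow 2)
    have h2 := (Real.continuous_sqrt.tendsto _).comp h1
    rw [zero_pow two_ne_zero, add_zero, Real.sqrt_sq (norm_nonneg x)] at h2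
    exact h2
  set F : E3 → ℝ := fun x => ‖x‖⁻¹ * Real.exp (-((μ.re - a) * ‖x‖)) with hF
  set F' : E3 → ℝ := fun x => ‖x‖⁻¹ * Real.exp (-((μ.re - a) * ‖x‖)) * (a + ‖x‖⁻¹ + ‖μ‖) with hF'
  have hFi : Integrable F := by
    have := integrable_norm_rpow_mul_exp (s := 1) (c := μ.re - a) (by norm_num) (by linarith)
    simpa only [Real.rpow_neg_one] using this
  have hF'i : Integrable F' := by
    have h1 := integrable_norm_rpow_mul_exp (s := 2) (c := μ.re - a) (by norm_num) (by linarith)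
    refine ((hFi.mul_const (a + ‖μ‖)).add h1).congr ?_
    filter_upwards [ae_ne_zero] with x hx
    have hr : 0 < ‖x‖ := norm_pos_iff.2 hx
    have e : ‖x‖ ^ (-2 : ℝ) = ‖x‖⁻¹ * ‖x‖⁻¹ := by
      rw [Real.rpow_neg hr.le, ← mul_inv, ← sq]; norm_cast
    simp only [Pi.add_apply, hF, hF', e]
    ring
  have hgm : AEStronglyMeasurable g volume := hg.continuous.aestronglyMeasurable
  have hg'm : AEStronglyMeasurable g' volume := hgc.aestronglyMeasurable
  have hSm : ∀ n, AEStronglyMeasurable (fun x => screened μ a (R n x) x) volume := fun n =>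
    ((measurable_screened μ a).comp ((hRc n).measurable.prodMk
      measurable_id)).aestronglyMeasurable
  have hGm : ∀ n, AEStronglyMeasurable (fun x => screenedGrad μ a j (R n x) x) volume := fun n =>
    ((measurable_screenedGrad μ a j).comp ((hRc n).measurable.prodMk
      measurable_id)).aestronglyMeasurable
  have hSb : ∀ n, ∀ᵐ x : E3, ‖screened μ a (R n x) x‖ ≤ F x := fun n => by
    filter_upwards [ae_ne_zero] with x hx using norm_screened_le ha hμ hx (hRge n x)
  have hGb : ∀ n, ∀ᵐ x : E3, ‖screenedGrad μ a j (R n x) x‖ ≤ F' x := fun n => by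
    filter_upwards [ae_ne_zero] with x hx using norm_screenedGrad_le ha hμ j hx (hRge n x)
  have hparts : ∀ n, ∫ x, screened μ a (R n x) x * g' x =
      -∫ x, screenedGrad μ a j (R n x) x * g x := by
    intro n
    have hSi : Integrable fun x => screened μ a (R n x) x := hFi.mono' (hSm n) (hSb n)
    have hGi : Integrable fun x => screenedGrad μ a j (R n x) x := hF'i.mono' (hGm n) (hGb n)
    have hd : ∀ x, HasFDerivAt (fun y => screened μ a (R n y) y)
        (gradForm fun j => screenedGrad μ a j (R n x) x) x := by
      intro x
      have hpos : 0 < ‖x‖ ^ 2 + ε n ^ 2 := by have := hε0 n; positivity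
      exact hasFDerivAt_screened (ρ := R n) (Real.sqrt_pos.2 hpos).ne'
        (hasFDerivAt_radius (ε n) hpos) μ a
    have h1 := integral_bilinear_hasFDerivAt_right_eq_neg_left_of_integrable
      (μ := (volume : Measure E3)) (B := ContinuousLinearMap.mul ℝ ℂ)
      (f := fun y => screened μ a (R n y) y)
      (f' := fun x => gradForm fun j => screenedGrad μ a j (R n x) x)
      (g := g) (g' := fun x => fderiv ℝ g x) (v := EuclideanSpace.single j 1)
      (by
        simp only [ContinuousLinearMap.mul_apply', gradForm_single]
        exact hGi.mul_bdd (c := B) hgm (Eventually.of_forall hB))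
      (by
        simp only [ContinuousLinearMap.mul_apply', ← hg']
        exact hSi.mul_bdd (c := B') hg'm (Eventually.of_forall hB'))
      (by
        simp only [ContinuousLinearMap.mul_apply']
        exact hSi.mul_bdd (c := B) hgm (Eventually.of_forall hB))
      (fun x _ => hd x) (fun x _ => (hg x).hasFDerivAt)
    simpa only [ContinuousLinearMap.mul_apply', gradForm_single, ← hg'] using h1
  have hlim1 : Tendsto (fun n => ∫ x, screened μ a (R n x) x * g' x) atTop
      (𝓝 (∫ x, screened μ a ‖x‖ x * g' x)) := by
    refine tendsto_integral_of_dominated_convergence (fun x => F x * B')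
      (fun n => (hSm n).mul hg'm) (hFi.mul_const _) (fun n => ?_) ?_
    · filter_upwards [hSb n] with x hx
      rw [norm_mul]
      exact mul_le_mul hx (hB' x) (norm_nonneg _) ((norm_nonneg _).trans hx)
    · filter_upwards [ae_ne_zero] with x hx
      exact ((continuousAt_screened μ a (norm_pos_iff.2 hx) x).tendsto.comp (hRt x)).mul_const _
  have hlim2 : Tendsto (fun n => ∫ x, screenedGrad μ a j (R n x) x * g x) atTop
      (𝓝 (∫ x, screenedGrad μ a j ‖x‖ x * g x)) := by
    refine tendsto_integral_of_dominated_convergence (fun x => F' x * B)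
      (fun n => (hGm n).mul hgm) (hF'i.mul_const _) (fun n => ?_) ?_
    · filter_upwards [hGb n] with x hx
      rw [norm_mul]
      exact mul_le_mul hx (hB x) (norm_nonneg _) ((norm_nonneg _).trans hx)
    · filter_upwards [ae_ne_zero] with x hx
      exact ((continuousAt_screenedGrad μ a j (norm_pos_iff.2 hx) x).tendsto.comp
        (hRt x)).mul_const _
  simp only [hparts] at hlim1
  exact tendsto_nhds_unique hlim1 hlim2.neg

lemma mode_eq_screened (a ϖ : ℝ) {k : ℤ} (hk : k ≠ 0) (x : E3) :
    mode a ϖ k x = screened (mass a (ϖ * k)) a ‖x‖ x := by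
  rw [mode, if_neg hk, screened, modeExp]

lemma gradMode_eq_screenedGrad (a ϖ : ℝ) (j : Fin 3) {k : ℤ} (hk : k ≠ 0) (x : E3) :
    gradMode a ϖ j k x = screenedGrad (mass a (ϖ * k)) a j ‖x‖ x := by
  rw [gradMode, mode_eq_screened a ϖ hk, screenedGrad]

lemma norm_gradx_le_sum {T : ℝ} (φ : AddCircle T → E3 → ℂ) (t : AddCircle T) (x : E3) :
    ‖gradx φ t x‖ ≤ ∑ j, ‖pdx j φ t x‖ := by
  rw [gradx, EuclideanSpace.norm_eq]
  exact Real.sqrt_le_iff.2 ⟨by positivity,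
    Finset.sum_sq_le_sq_sum_of_nonneg fun _ _ => norm_nonneg _⟩

/-! ### Identification of the series with the distribution φ_⊥. -/

section Distribution

variable {T : ℝ} [hT : Fact (0 < T)] {ψ : AddCircle T → E3 → ℂ} {a ϖ b C lam : ℝ}

/-- Fubini freezes t, where the spatial integration by parts applies to the slice of ψ. This
transfers the distributional derivative mode by mode. -/
lemma integral_mode_mul_pdx (ha : 0 < a) (hϖ : 0 < ϖ) (h0 : IsAdmissible 0 b C (mode a ϖ))
    (h1 : ∀ j, IsAdmissible 1 b C (gradMode a ϖ j)) (hψ : IsSchwartzBruhat T ψ) (j : Fin 3)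
    (k : ℤ) :
    ∫ z, fourier k z.1 * mode a ϖ k z.2 * pdx j ψ z.1 z.2 ∂(haarG T) =
      -∫ z, fourier k z.1 * gradMode a ϖ j k z.2 * ψ z.1 z.2 ∂(haarG T) := by
  by_cases hk : k = 0
  · subst hk
    simp [h0.zero, (h1 j).zero]
  have hψ' := hψ.pdx j
  have hi := integrable_mode_mul_test (h0.integrable zero_le_one k) hψ' k
  have hi' := integrable_mode_mul_test ((h1 j).integrable le_rfl k) hψ k
  obtain ⟨c, hc, hmass⟩ := exists_massRe_ge ha hϖ
  have hμ : a < (mass a (ϖ * k)).re := by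
    have hk1 := one_le_abs_intCast hk
    have h2 : 0 < c * √|(k : ℝ)| := mul_pos hc (Real.sqrt_pos.2 (by linarith))
    have h3 : (mass a (ϖ * k)).re = massRe a (ϖ * k) := rfl
    linarith [hmass k hk]
  obtain ⟨B, -, hB⟩ := hψ.exists_norm_le
  obtain ⟨B', -, hB'⟩ := hψ'.exists_norm_le
  obtain ⟨_, _, hS⟩ := hψ.exists_schwartz
  rw [haarG] at hi hi' ⊢
  rw [integral_prod _ hi, integral_prod _ hi', ← integral_neg]
  refine integral_congr_ae (Eventually.of_forall fun t => ?_)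
  obtain ⟨g, hg, -⟩ := hS t
  have hd : Differentiable ℝ (ψ t) := by
    rw [← funext hg]; exact g.differentiable
  have hcont : Continuous (pdx j ψ t) :=
    hψ'.continuous.comp (f := fun x : E3 => (t, x)) (by fun_prop)
  have key := integral_screened_mul_fderiv ha hμ j hd (g' := pdx j ψ t) (fun _ => rfl) hcont
    (hB t) (hB' t)
  simp only [mul_assoc, integral_const_mul, mode_eq_screened a ϖ hk,
    gradMode_eq_screenedGrad a ϖ j hk]
  rw [key, mul_neg]

lemma phiPerpDist_eq_tsum (hlam : 0 < lam)
    (h0 : IsAdmissible 0 b C (mode (lam / 2) (2 * Real.pi / T))) (hψ : IsSchwartzBruhat T ψ) :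
    phiPerpDist lam T ψ = ∑' k : ℤ,
      ∫ z, fourier k z.1 * mode (lam / 2) (2 * Real.pi / T) k z.2 * ψ z.1 z.2 ∂(haarG T) := by
  rw [phiPerpDist, invFourierG]
  refine tsum_congr fun k => ?_
  by_cases hk : k = 0
  · subst hk
    simp [h0.zero, symbolPerp]
  · exact mode_pairing (h0.integrable zero_le_one k) (fourier_mode hlam hT.out hk) hψ k

/-- The sum of the modes is the function `φ_⊥`. -/
lemma isPhiPerp_modeSum (hlam : 0 < lam)
    (h0 : IsAdmissible 0 b C (mode (lam / 2) (2 * Real.pi / T)))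
    (h1 : ∀ j, IsAdmissible 1 b C (gradMode (lam / 2) (2 * Real.pi / T) j)) :
    IsPhiPerp lam T (modeSum (mode (lam / 2) (2 * Real.pi / T))) := by
  have hϖ : 0 < 2 * Real.pi / T := div_pos Real.two_pi_pos hT.out
  refine ⟨fun ψ hψ => ⟨h0.integrable_modeSum_mul zero_le_one hψ, ?_⟩, fun j ψ hψ => ?_,
    h0.continuousOn_modeSum T, fun t x hx => (hasFDerivAt_modeSum h0 h1 t hx).differentiableAt, ?_⟩
  · rw [phiPerpDist_eq_tsum hlam h0 hψ]
    exact (h0.hasSum_pairing zero_le_one hψ).tsum_eq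
  -- The pointwise derivative is known only for x ≠ 0, which is enough because the excluded set is
  -- null.
  · have hae : (fun z : AddCircle T × E3 =>
        modeSum (gradMode (lam / 2) (2 * Real.pi / T) j) z.1 z.2 * ψ z.1 z.2) =ᵐ[haarG T]
        fun z => pdx j (modeSum (mode (lam / 2) (2 * Real.pi / T))) z.1 z.2 * ψ z.1 z.2 := by
      filter_upwards [ae_haarG_snd_ne_zero] with z hz
      rw [pdx_modeSum h0 h1 j z.1 hz]
    refine ⟨((h1 j).integrable_modeSum_mul le_rfl hψ).congr hae, ?_⟩
    rw [← integral_congr_ae hae, distPdx, phiPerpDist_eq_tsum hlam h0 (hψ.pdx j)]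
    simp only [integral_mode_mul_pdx (half_pos hlam) hϖ h0 h1 hψ j]
    rw [tsum_neg, neg_neg]
    exact ((h1 j).hasSum_pairing le_rfl hψ).tsum_eq
  · have hc : ContinuousOn (fun z : AddCircle T × E3 => WithLp.toLp 2 fun j =>
        modeSum (gradMode (lam / 2) (2 * Real.pi / T) j) z.1 z.2) {z | z.2 ≠ 0} :=
      (PiLp.continuous_toLp 2 _).comp_continuousOn
        (continuousOn_pi.2 fun j => (h1 j).continuousOn_modeSum T)
    refine hc.congr fun z hz => ?_
    simp only [gradx, pdx_modeSum h0 h1 _ z.1 hz]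

end Distribution

/-! ### The L^q estimates in time. -/

section Estimates

variable {T : ℝ} [hT : Fact (0 < T)]

lemma eLpNorm_le_of_norm_le_weight {E : Type*} [NormedAddCommGroup E] {γ q : ℝ} (hγ1 : γ < 1)
    (hq : 1 ≤ q) (hq' : q < 1 / (1 - γ)) {F : AddCircle T → E} {A : ℝ} (hA : 0 ≤ A)
    (hF : ∀ t, 0 < ‖fourier 1 t - 1‖ → ‖F t‖ ≤ A * ‖fourier 1 t - 1‖ ^ (-(1 - γ))) :
    eLpNorm F (ENNReal.ofReal q) AddCircle.haarAddCircle ≤ ENNReal.ofReal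
      (A * (eLpNorm (fun t : AddCircle T => ‖fourier 1 t - 1‖ ^ (-(1 - γ))) (ENNReal.ofReal q)
        AddCircle.haarAddCircle).toReal) := by
  have hW := eLpNorm_fourier_weight_lt_top (T := T) hγ1 hq hq'
  rw [ENNReal.ofReal_mul hA, ENNReal.ofReal_toReal hW.ne]
  refine eLpNorm_le_mul_eLpNorm_of_ae_le_mul ?_ _
  filter_upwards [ae_fourier_one_ne_one] with t ht
  rw [Real.norm_of_nonneg (by positivity)]
  exact hF t ht

end Estimates

end TimePeriodic

theorem theorem4p4 (lam T : ℝ) (hlam : 0 < lam) [Fact (0 < T)] :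
    ∃ φ : AddCircle T → TimePeriodic.E3 → ℂ, TimePeriodic.IsPhiPerp lam T φ ∧
      ∃ C₃ : ℝ, 0 < C₃ ∧
        ∀ γ : ℝ, 0 < γ → γ < 1 → ∀ q : ℝ, 1 ≤ q → q < 1 / (1 - γ) →
          ∃ C : ℝ, 0 < C ∧ ∀ x : TimePeriodic.E3, x ≠ 0 →
            eLpNorm (fun t => φ t x) (ENNReal.ofReal q) AddCircle.haarAddCircle ≤
                ENNReal.ofReal (C * ‖x‖ ^ (-(1 + 2 * γ)) * Real.exp (-(C₃ * ‖x‖))) ∧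
            eLpNorm (fun t => TimePeriodic.gradx φ t x) (ENNReal.ofReal q)
                AddCircle.haarAddCircle ≤
                ENNReal.ofReal (C * ‖x‖ ^ (-(2 + 2 * γ)) * Real.exp (-(C₃ * ‖x‖))) := by
  have hϖ : 0 < 2 * Real.pi / T := div_pos Real.two_pi_pos Fact.out
  obtain ⟨b, C, h0, h1⟩ := TimePeriodic.exists_isAdmissible (half_pos hlam) hϖ
  have hb := h0.b_pos
  have hC := h0.C_nonneg
  -- The rate b/2 comes from the gap alone, hence depends only on λ and T; γ and q enter the
  -- constant only through the norm `W` of the weight.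
  refine ⟨_, TimePeriodic.isPhiPerp_modeSum hlam h0 h1, b / 2, half_pos hb,
    fun γ hγ0 hγ1 q hq hq' => ?_⟩
  set W : ℝ := (eLpNorm (fun t : AddCircle T => ‖fourier 1 t - 1‖ ^ (-(1 - γ)))
    (ENNReal.ofReal q) AddCircle.haarAddCircle).toReal
  have hW : 0 ≤ W := ENNReal.toReal_nonneg
  set K : ℝ := 16 * C / b ^ 2 + (3 * C + 8 * C / b) with hK
  have hK0 : 0 ≤ K := by positivity
  -- The 3 counts the partial derivatives in the gradient; the 1 makes the constant strictly
  -- positive.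
  refine ⟨3 * K * W + 1, by positivity, fun x hx => ⟨?_, ?_⟩⟩
  · set A : ℝ := ‖x‖ ^ (-(1 + 2 * γ)) * Real.exp (-(b / 2 * ‖x‖)) with hA
    have hA0 : 0 ≤ A := by positivity
    refine (TimePeriodic.eLpNorm_le_of_norm_le_weight hγ1 hq hq' (A := K * A) (by positivity)
      fun t ht => ?_).trans (ENNReal.ofReal_le_ofReal ?_)
    · refine (h0.norm_modeSum_le hγ0 hγ1 hx ht).trans (le_of_eq ?_)
      rw [Nat.cast_zero, zero_add, hA, hK]
      ring
    · rw [mul_assoc (3 * K * W + 1), ← hA]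
      nlinarith [mul_nonneg (mul_nonneg hK0 hW) hA0]
  · set A : ℝ := ‖x‖ ^ (-(2 + 2 * γ)) * Real.exp (-(b / 2 * ‖x‖)) with hA
    have hA0 : 0 ≤ A := by positivity
    refine (TimePeriodic.eLpNorm_le_of_norm_le_weight hγ1 hq hq' (A := 3 * K * A) (by positivity)
      fun t ht => ?_).trans (ENNReal.ofReal_le_ofReal ?_)
    · refine (TimePeriodic.norm_gradx_le_sum _ t x).trans ?_
      have hj : ∀ j ∈ Finset.univ, ‖TimePeriodic.pdx j (TimePeriodic.modeSum
          (TimePeriodic.mode (lam / 2) (2 * Real.pi / T))) t x‖ ≤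
          K * A * ‖fourier 1 t - 1‖ ^ (-(1 - γ)) := by
        intro j _
        rw [TimePeriodic.pdx_modeSum h0 h1 j t hx]
        refine ((h1 j).norm_modeSum_le hγ0 hγ1 hx ht).trans (le_of_eq ?_)
        rw [Nat.cast_one, one_add_one_eq_two, hA, hK]
        ring
      refine (Finset.sum_le_card_nsmul _ _ _ hj).trans (le_of_eq ?_)
      rw [Finset.card_univ, Fintype.card_fin, nsmul_eq_mul]
      push_cast
      ring
    · rw [mul_assoc (3 * K * W + 1), ← hA]
      nlinarith [mul_nonneg (mul_nonneg hK0 hW) hA0]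

end
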